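/- For every constant $c\in\mathbb N$ there are constants $C$ and $k$ such that the following holds for all $n,\Delta\in\mathbb N$ and all real $s\ge 1$ (where $s$ may depend on $n$ and $\Delta$). There is a randomized one-pass streaming algorithm, which may depend on $n$, $\Delta$ and $s$, with a memory of at most $C\,n s\,(\log n)^{k}$ bits (that is, it uses $\widetilde O(ns)$ space) and with a palette of at most $C\,(\Delta^{1.5}/s+\Delta)$ colors, such that for every simple graph $G$ on $n$ vertices of maximum degree at most $\Delta$ and for every order in which the edges of $G$ arrive one by one, with probability at least $1-n^{-c}$ the algorithm reports a proper edge coloring of $G$ with colors from the palette. Here a randomized one-pass streaming algorithm with a memory of $b$ bits has a random initial memory content in $\{0,1\}^b$; when an edge arrives, it draws a new memory content, and a finite list of pairs (edge, color) that it writes to a write-only output stream, from a distribution that depends only on its present memory content and on the arriving edge; when the stream ends, it writes a last list of such pairs, drawn from a distribution that depends only on its memory content. Random choices that are used again later thus have to be kept in memory. It reports a proper edge coloring of $G$ if its whole output contains every edge of $G$ exactly once and nothing else, and any two distinct edges that share an endpoint are paired with different colors. -/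

import Mathlib

/-- The contents of a memory of `b` bits. -/
abbrev Memory (b : ℕ) : Type := Fin b → Bool

/-- A randomized one-pass streaming algorithm on graphs with vertex set `V` that has a memory of
`b` bits and writes its output, pairs (edge, color) with colors from a palette of size `K`, to a
write-only output stream.

Between two arrivals the algorithm keeps nothing but its `b` bits of memory. Its coins are part of
the transitions: a random choice that is to be used again later has to be kept in memory. -/
structure StreamingColoringAlgorithm (V : Type) (b K : ℕ) where
  /-- the random initial memory -/
  init : PMF (Memory b)
  /-- on the arrival of an edge: the new memory, and what is written to the output stream -/
  step : Memory b → Sym2 V → PMF (Memory b × List (Sym2 V × Fin K))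
  /-- what is written to the output stream when the input has ended -/
  finish : Memory b → PMF (List (Sym2 V × Fin K))

namespace StreamingColoringAlgorithm

variable {V : Type} {b K : ℕ}

/-- The law of the output that is written from the time on at which the memory is `M` and the
remaining input is the given list of edges. -/
noncomputable def runFrom (A : StreamingColoringAlgorithm V b K) :
    Memory b → List (Sym2 V) → PMF (List (Sym2 V × Fin K))
  | M, [] => A.finish M
  | M, e :: σ => (A.step M e).bind fun r => (A.runFrom r.1 σ).map fun out => r.2 ++ out

/-- The law of the whole output on the input stream `σ`, which is read once from left to right. -/
noncomputable def run (A : StreamingColoringAlgorithm V b K) (σ : List (Sym2 V)) :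
    PMF (List (Sym2 V × Fin K)) :=
  A.init.bind fun M => A.runFrom M σ

end StreamingColoringAlgorithm

/-- `σ` is an arrival order of the edges of `G`: every edge arrives exactly once. -/
def IsArrivalOrder {V : Type} (G : SimpleGraph V) (σ : List (Sym2 V)) : Prop :=
  σ.Nodup ∧ ∀ e, e ∈ σ ↔ e ∈ G.edgeSet

/-- The output `out` reports a proper edge coloring of `G` with palette `Fin K`: there is a proper
edge coloring `χ` (a vertex coloring of the line graph) such that `out` lists, in some order and
without repetition, exactly the pairs `(e, χ e)` for the edges `e` of `G`. -/
def ReportsProperEdgeColoring {V : Type} (G : SimpleGraph V) {K : ℕ}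
    (out : List (Sym2 V × Fin K)) : Prop :=
  out.Nodup ∧ ∃ χ : G.lineGraph.Coloring (Fin K),
    ∀ e a, (e, a) ∈ out ↔ ∃ he : e ∈ G.edgeSet, χ ⟨e, he⟩ = a

/-- The probability that the algorithm `A`, on the input stream `σ`, reports a proper edge coloring
of `G`. -/
noncomputable def StreamingColoringAlgorithm.successProb {V : Type} {b K : ℕ}
    (A : StreamingColoringAlgorithm V b K) (G : SimpleGraph V) (σ : List (Sym2 V)) : ℝ :=
  ((A.run σ).toOuterMeasure {out | ReportsProperEdgeColoring G out}).toReal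

/-!
An edge coloring of a graph of maximum degree `D` in one pass, with `O(D ^ 1.5 / s + D)` colors and
a memory of `Õ(n * s)` bits, succeeding with high probability.

All random choices are made in advance: the algorithm is a family of deterministic ones
(`OnlineColorer`) with a uniformly random index, the seed, which is short enough to stay in memory
(`exists_streamingColoringAlgorithm`). The stream does not depend on the seed, so failure
probabilities can be estimated for one fixed stream.

*Bipartite graphs.* Let `b ≈ √D`, and let `q ≈ min s b`. Edges are buffered. As soon as some vertex
`v` has `b` buffered edges, these leave the buffer as a star with center `v`; as soon as `n * q`
edges are buffered, all of them leave as a batch (`EdgeBuffer`). A batch has maximum degree less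
than `b`, and there are at most `D / q` full batches, so that fresh colors for each batch amount to
`O(b * D / q)` colors. A vertex is the center of at most `D / b ≤ b` stars. The star colors are
divided into `q` classes, and each class into about `b / q` groups of `O(D / q)` colors. The `j`-th
star of `v` gets the class `(j + ρ v) % q`, where `ρ v` is random, and the group `j / q`; so
different stars of `v` never share a color. A leaf `u` cannot remember all the colors that it has
seen, but a counter for each class is affordable. The counter points to a window of `2 * w`
positions, `w` being of order `log n`; each window serves `w` edges of `u`, and `u` remembers the
positions that it has used in its current window only. The windows of `u` are passed through in
cyclic order from a random start `r (u, a)`. Greedy choice in the windows of a star succeeds if no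
window is shared by more than `w` leaves of the star (`exists_positions`). Hence the coloring is
proper (`colorEvents_isProperReport`) unless a counter runs out of windows or a window is crowded.
Both are unlikely (`unifProb_not_isGoodSeed_le`): the sequence of stars and batches does not depend
on the seed; the stars with leaf `u` have distinct centers, so their classes are independent; and
the leaves of a star start at independent windows. In each case an exponential moment
(`unifProb_card_filter_le`) bounds the number of independent events that occur.

The centers of stars must be told apart from the leaves: the color of a star records the side of its
center, and an edge at `x` has center `x` if and only if that side is the side of `x`. This is where
bipartiteness is used.

*General graphs.* A random bipartition of the vertices is drawn. The crossing edges are colored as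
above, and with high probability the other edges form a graph of maximum degree at most `3 * D / 4`
(`unifProb_not_isStream_le`), which is treated recursively with a disjoint palette. The numbers of
colors decrease geometrically, and there are `O(log n)` levels. Once `D` is polylogarithmic, the
graph is stored (`hasColorer_of_degree_le`).
-/

/-! ### Deterministic online colorers -/

/-- A deterministic one-pass coloring algorithm with states `S` and colors `κ`. A randomized
algorithm is a family of these, indexed by a seed. -/
structure OnlineColorer (V S κ : Type) where
  /-- the initial state -/
  init : S
  /-- on the arrival of an edge: the new state, and what is written -/
  step : S → Sym2 V → S × List (Sym2 V × κ)
  /-- what is written at the end of the stream -/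
  finish : S → List (Sym2 V × κ)

namespace OnlineColorer

variable {V S κ : Type}

/-- Everything that is written from state `s` on, if the rest of the stream is the given list. -/
def outputFrom (A : OnlineColorer V S κ) : S → List (Sym2 V) → List (Sym2 V × κ)
  | s, [] => A.finish s
  | s, e :: σ => (A.step s e).2 ++ A.outputFrom (A.step s e).1 σ

/-- The whole output on a stream. -/
def output (A : OnlineColorer V S κ) (σ : List (Sym2 V)) : List (Sym2 V × κ) :=
  A.outputFrom A.init σ

end OnlineColorer

/-- The output `out` lists every edge of `E` exactly once, and two listed edges that share an
endpoint and have the same color are equal. -/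
def IsProperReport {V κ : Type} (E : List (Sym2 V)) (out : List (Sym2 V × κ)) : Prop :=
  (out.map Prod.fst).Perm E ∧
    ∀ x ∈ out, ∀ y ∈ out, x.2 = y.2 → (∃ v, v ∈ x.1 ∧ v ∈ y.1) → x.1 = y.1

/-- A stream of a simple graph of maximum degree at most `D`. -/
structure IsStream {V : Type} [DecidableEq V] (D : ℕ) (σ : List (Sym2 V)) : Prop where
  nodup : σ.Nodup
  not_isDiag : ∀ e ∈ σ, ¬ e.IsDiag
  degree_le : ∀ v, (σ.filter (v ∈ ·)).length ≤ D

theorem IsStream.filter {V : Type} [DecidableEq V] {D : ℕ} {σ : List (Sym2 V)}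
    (h : IsStream D σ) (f : Sym2 V → Bool) : IsStream D (σ.filter f) where
  nodup := h.nodup.filter _
  not_isDiag e he := h.not_isDiag e (List.mem_of_mem_filter he)
  degree_le v := by
    refine le_trans ?_ (h.degree_le v)
    exact List.Sublist.length_le (List.Sublist.filter _ List.filter_sublist)

theorem IsProperReport.perm {V κ : Type} {E : List (Sym2 V)} {o o' : List (Sym2 V × κ)}
    (h : IsProperReport E o) (hp : o'.Perm o) : IsProperReport E o' :=
  ⟨(hp.map _).trans h.1, fun x hx y hy => h.2 x (hp.mem_iff.1 hx) y (hp.mem_iff.1 hy)⟩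

theorem IsProperReport.map_color {V κ κ' : Type} {E : List (Sym2 V)} {o : List (Sym2 V × κ)}
    (h : IsProperReport E o) {f : κ → κ'} (hf : Function.Injective f) :
    IsProperReport E (o.map (Prod.map id f)) := by
  refine ⟨by simpa [List.map_map, Function.comp_def] using h.1, ?_⟩
  intro x hx y hy hc hv
  obtain ⟨x', hx', rfl⟩ := List.mem_map.1 hx
  obtain ⟨y', hy', rfl⟩ := List.mem_map.1 hy
  exact h.2 x' hx' y' hy' (hf hc) hv

/-- Reports with disjoint palettes can be united. -/
theorem IsProperReport.append_sum {V κ κ' : Type} {E E' : List (Sym2 V)}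
    {o : List (Sym2 V × κ)} {o' : List (Sym2 V × κ')}
    (h : IsProperReport E o) (h' : IsProperReport E' o') :
    IsProperReport (E ++ E')
      (o.map (Prod.map id Sum.inl) ++ o'.map (Prod.map id Sum.inr) :
        List (Sym2 V × (κ ⊕ κ'))) := by
  refine ⟨?_, ?_⟩
  · rw [List.map_append]
    refine List.Perm.append ?_ ?_
    · simpa [List.map_map, Function.comp_def] using h.1
    · simpa [List.map_map, Function.comp_def] using h'.1
  · intro x hx y hy hc hv
    rw [List.mem_append, List.mem_map, List.mem_map] at hx hy
    rcases hx with ⟨x, hx, rfl⟩ | ⟨x, hx, rfl⟩ <;> rcases hy with ⟨y, hy, rfl⟩ | ⟨y, hy, rfl⟩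
    · exact h.2 x hx y hy (Sum.inl_injective hc) hv
    · simp at hc
    · simp at hc
    · exact h'.2 x hx y hy (Sum.inr_injective hc) hv

/-- A proper report of the edge set of `G` in the list sense, with colors mapped injectively to the
palette, is a proper edge coloring of `G`. -/
theorem IsProperReport.reports {V : Type} {G : SimpleGraph V} {σ : List (Sym2 V)} {K : ℕ}
    {o : List (Sym2 V × Fin K)} (hσ : IsArrivalOrder G σ) (h : IsProperReport σ o) :
    ReportsProperEdgeColoring G o := by
  have hnd : (o.map Prod.fst).Nodup := h.1.nodup_iff.2 hσ.1
  have hmem : ∀ e, e ∈ G.edgeSet ↔ ∃ a, (e, a) ∈ o := by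
    intro e
    rw [← hσ.2, ← h.1.mem_iff]
    simp
  have huniq : ∀ e a a', (e, a) ∈ o → (e, a') ∈ o → a = a' := by
    intro e a a' h1 h2
    have := List.inj_on_of_nodup_map hnd h1 h2 rfl
    exact (Prod.ext_iff.1 this).2
  choose f hf using fun e : G.edgeSet => (hmem e.1).1 e.2
  refine ⟨hnd.of_map _, SimpleGraph.Coloring.mk f ?_, ?_⟩
  · intro e e' hadj hfe
    rw [SimpleGraph.lineGraph_adj_iff_exists] at hadj
    obtain ⟨hne, v, hv, hv'⟩ := hadj
    exact hne (Subtype.ext (h.2 _ (hf e) _ (hf e') hfe ⟨v, hv, hv'⟩))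
  · intro e a
    constructor
    · intro hea
      exact ⟨(hmem e).2 ⟨a, hea⟩, huniq _ _ _ (hf _) hea⟩
    · rintro ⟨he, rfl⟩
      exact hf ⟨e, he⟩

namespace OnlineColorer

variable {V S S' κ κ' : Type}

/-- Runs two colorers side by side, with disjoint palettes; the first one gets the edges that
satisfy `f`, and the second one gets the others. -/
def split (f : Sym2 V → Bool) (A : OnlineColorer V S κ) (B : OnlineColorer V S' κ') :
    OnlineColorer V (S × S') (κ ⊕ κ') where
  init := (A.init, B.init)
  step s e := if f e then
      (((A.step s.1 e).1, s.2), (A.step s.1 e).2.map (Prod.map id Sum.inl))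
    else ((s.1, (B.step s.2 e).1), (B.step s.2 e).2.map (Prod.map id Sum.inr))
  finish s := (A.finish s.1).map (Prod.map id Sum.inl) ++ (B.finish s.2).map (Prod.map id Sum.inr)

theorem split_outputFrom_perm (f : Sym2 V → Bool) (A : OnlineColorer V S κ)
    (B : OnlineColorer V S' κ') (σ : List (Sym2 V)) (s : S) (s' : S') :
    ((split f A B).outputFrom (s, s') σ).Perm
      ((A.outputFrom s (σ.filter f)).map (Prod.map id Sum.inl) ++
        (B.outputFrom s' (σ.filter fun e => !f e)).map (Prod.map id Sum.inr)) := by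
  induction σ generalizing s s' with
  | nil => exact List.Perm.refl _
  | cons e σ ih =>
    by_cases he : f e
    · simp only [outputFrom, split, he, if_true, List.filter_cons_of_pos]
      rw [List.filter_cons_of_neg (by simp [he]), List.map_append, List.append_assoc]
      exact List.Perm.append_left _ (ih _ _)
    · simp only [outputFrom, split, he]
      rw [List.filter_cons_of_neg (by simpa using he), List.filter_cons_of_pos (by simp [he])]
      simp only [outputFrom, List.map_append]
      refine (List.Perm.append_left _ (ih _ _)).trans ?_
      rw [← List.append_assoc, ← List.append_assoc]
      exact List.Perm.append_right _ List.perm_append_comm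

theorem split_isProperReport {f : Sym2 V → Bool} {A : OnlineColorer V S κ}
    {B : OnlineColorer V S' κ'} {σ : List (Sym2 V)}
    (hA : IsProperReport (σ.filter f) (A.output (σ.filter f)))
    (hB : IsProperReport (σ.filter fun e => !f e) (B.output (σ.filter fun e => !f e))) :
    IsProperReport σ ((split f A B).output σ) := by
  have h := (hA.append_sum hB).perm (split_outputFrom_perm f A B σ A.init B.init)
  exact ⟨h.1.trans (List.filter_append_perm f σ), h.2⟩

/-- The state after the edges of a list have arrived. -/
def stateAfter (A : OnlineColorer V S κ) (s : S) (σ : List (Sym2 V)) : S :=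
  σ.foldl (fun s e => (A.step s e).1) s

/-- The same algorithm with its states written as elements of `F`, by means of `enc`; `dec` reads
them back. -/
def encode {F : Type} (A : OnlineColorer V S κ) (enc : S → F) (dec : F → S) :
    OnlineColorer V F κ where
  init := enc A.init
  step x e := (enc (A.step (dec x) e).1, (A.step (dec x) e).2)
  finish x := A.finish (dec x)

/-- Only the states that are reached on the stream have to survive the encoding. -/
theorem encode_output {F : Type} (A : OnlineColorer V S κ) (enc : S → F) (dec : F → S)
    (σ : List (Sym2 V)) (h : ∀ p, p <+: σ → dec (enc (A.stateAfter A.init p)) =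
      A.stateAfter A.init p) : (A.encode enc dec).output σ = A.output σ := by
  have key : ∀ (σ : List (Sym2 V)) (s : S),
      (∀ p, p <+: σ → dec (enc (A.stateAfter s p)) = A.stateAfter s p) →
      (A.encode enc dec).outputFrom (enc s) σ = A.outputFrom s σ := by
    intro σ
    induction σ with
    | nil => intro s hs; have := hs [] (List.nil_prefix); simp [stateAfter] at this
             simp [outputFrom, encode, this]
    | cons e σ ih =>
      intro s hs
      have h0 : dec (enc s) = s := hs [] List.nil_prefix
      have := ih (A.step s e).1 (fun p hp => by
        obtain ⟨t, rfl⟩ := hp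
        exact hs (e :: p) ⟨t, rfl⟩)
      simp only [outputFrom, ← this]
      simp only [encode, h0]
  exact key σ A.init h

end OnlineColorer

/-! ### Uniform seeds -/

open Classical in
/-- The probability of `p` under a uniformly random element of a finite type. -/
noncomputable def unifProb {Ω : Type} [Fintype Ω] (p : Ω → Prop) : ℝ :=
  ((Finset.univ.filter p).card : ℝ) / Fintype.card Ω

/-- A family of online colorers with a uniformly random index becomes a randomized streaming
algorithm that keeps the index and the state in its memory. -/
theorem exists_streamingColoringAlgorithm {V Ω S κ : Type} [Fintype Ω] [Nonempty Ω] [Fintype S]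
    [Fintype κ] (A : Ω → OnlineColorer V S κ) {b K : ℕ}
    (hb : Fintype.card Ω * Fintype.card S ≤ 2 ^ b) (hK : Fintype.card κ ≤ K) :
    ∃ B : StreamingColoringAlgorithm V b K, ∀ (G : SimpleGraph V) (σ : List (Sym2 V)),
      IsArrivalOrder G σ →
      1 - unifProb (fun ω => ¬ IsProperReport σ ((A ω).output σ)) ≤ B.successProb G σ := by
  classical
  obtain ⟨enc⟩ : Nonempty (Ω × S ↪ Memory b) :=
    Function.Embedding.nonempty_of_card_le (by simpa using hb)
  obtain ⟨col⟩ : Nonempty (κ ↪ Fin K) :=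
    Function.Embedding.nonempty_of_card_le (by simpa using hK)
  obtain ⟨ω₀⟩ := ‹Nonempty Ω›
  have : Nonempty (Ω × S) := ⟨(ω₀, (A ω₀).init)⟩
  have hdec : ∀ x, Function.invFun enc (enc x) = x := Function.leftInverse_invFun enc.injective
  set dec := Function.invFun enc with hdecdef
  let B : StreamingColoringAlgorithm V b K :=
    { init := (PMF.uniformOfFintype Ω).map fun ω => enc (ω, (A ω).init)
      step := fun M e => PMF.pure (enc ((dec M).1, ((A (dec M).1).step (dec M).2 e).1),
        ((A (dec M).1).step (dec M).2 e).2.map (Prod.map id col))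
      finish := fun M => PMF.pure (((A (dec M).1).finish (dec M).2).map (Prod.map id col)) }
  have hrun : ∀ (ω : Ω) (σ : List (Sym2 V)) (s : S),
      B.runFrom (enc (ω, s)) σ = PMF.pure (((A ω).outputFrom s σ).map (Prod.map id col)) := by
    intro ω σ
    induction σ with
    | nil =>
      intro s
      simp [StreamingColoringAlgorithm.runFrom, OnlineColorer.outputFrom, B, hdec]
    | cons e σ ih =>
      intro s
      simp only [StreamingColoringAlgorithm.runFrom]
      have : B.step (enc (ω, s)) e = PMF.pure (enc (ω, ((A ω).step s e).1),
          ((A ω).step s e).2.map (Prod.map id col)) := by simp [B, hdec]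
      rw [this, PMF.pure_bind]
      simp only [ih, PMF.pure_map, OnlineColorer.outputFrom, List.map_append]
  refine ⟨B, fun G σ hσ => ?_⟩
  have hB : B.run σ = (PMF.uniformOfFintype Ω).map
      fun ω => ((A ω).output σ).map (Prod.map id col) := by
    rw [StreamingColoringAlgorithm.run, show B.init = (PMF.uniformOfFintype Ω).map
      fun ω => enc (ω, (A ω).init) from rfl, PMF.bind_map, PMF.map]
    exact congrArg _ (funext fun ω => hrun ω σ _)
  rw [StreamingColoringAlgorithm.successProb, hB, PMF.toOuterMeasure_map_apply,
    PMF.toOuterMeasure_uniformOfFintype_apply, ENNReal.toReal_div, ENNReal.toReal_natCast,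
    ENNReal.toReal_natCast, unifProb]
  have hc : (0 : ℝ) < Fintype.card Ω := by exact_mod_cast Fintype.card_pos
  rw [sub_le_iff_le_add, ← add_div, le_div_iff₀ hc, one_mul]
  rw [Fintype.card_ofFinset]
  norm_cast
  rw [← Finset.card_univ]
  refine le_trans (Finset.card_le_card ?_) (Finset.card_union_le _ _)
  intro ω _
  by_cases h : IsProperReport σ ((A ω).output σ)
  · refine Finset.mem_union_left _ ?_
    simp only [Finset.mem_filter, Finset.mem_univ, true_and, Set.mem_preimage, Set.mem_ofPred_eq]
    exact (h.map_color col.injective).reports hσ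
  · exact Finset.mem_union_right _ (by simpa using h)

section UniformProbability

variable {Ω Ω' : Type} [Fintype Ω] [Fintype Ω']

theorem unifProb_eq (p : Ω → Prop) [DecidablePred p] :
    unifProb p = ((Finset.univ.filter p).card : ℝ) / Fintype.card Ω := by
  unfold unifProb
  congr!

theorem unifProb_mono {p q : Ω → Prop} (h : ∀ ω, p ω → q ω) : unifProb p ≤ unifProb q := by
  classical
  unfold unifProb
  gcongr with ω
  exact h ω

theorem unifProb_nonneg (p : Ω → Prop) : 0 ≤ unifProb p := by
  unfold unifProb; positivity

theorem unifProb_of_forall_not {p : Ω → Prop} (h : ∀ ω, ¬ p ω) : unifProb p = 0 := by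
  classical
  simp [unifProb, h]

theorem unifProb_or_le (p q : Ω → Prop) :
    unifProb (fun ω => p ω ∨ q ω) ≤ unifProb p + unifProb q := by
  classical
  unfold unifProb
  rw [← add_div]
  gcongr
  norm_cast
  refine le_trans (Finset.card_le_card ?_) (Finset.card_union_le _ _)
  intro ω
  simp

theorem unifProb_exists_le {τ : Type} (J : Finset τ) (p : τ → Ω → Prop) {δ : ℝ}
    (h : ∀ x ∈ J, unifProb (p x) ≤ δ) : unifProb (fun ω => ∃ x ∈ J, p x ω) ≤ J.card * δ := by
  classical
  have : unifProb (fun ω => ∃ x ∈ J, p x ω) ≤ ∑ x ∈ J, unifProb (p x) := by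
    unfold unifProb
    rw [← Finset.sum_div]
    gcongr
    norm_cast
    refine le_trans (Finset.card_le_card ?_) Finset.card_biUnion_le
    intro ω hω
    simpa using hω
  refine this.trans ((Finset.sum_le_sum h).trans ?_)
  simp

/-- A bound for every value of the first seed is a bound for the pair of seeds. -/
theorem unifProb_prod_le {p : Ω × Ω' → Prop} {δ : ℝ} [Nonempty Ω]
    (h : ∀ ω, unifProb (fun ω' => p (ω, ω')) ≤ δ) : unifProb p ≤ δ := by
  classical
  have hc : (0 : ℝ) < Fintype.card Ω := by exact_mod_cast Fintype.card_pos
  have h1 : ((Finset.univ.filter p).card : ℝ) =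
      ∑ ω : Ω, ((Finset.univ.filter fun ω' => p (ω, ω')).card : ℝ) := by
    norm_cast
    simp_rw [Finset.card_filter]
    rw [Fintype.sum_prod_type]
  have h2 : unifProb p = (∑ ω : Ω, unifProb (fun ω' => p (ω, ω'))) / Fintype.card Ω := by
    unfold unifProb
    rw [← Finset.sum_div, h1, Fintype.card_prod, Nat.cast_mul, div_div, mul_comm]
  rw [h2, div_le_iff₀ hc]
  refine (Finset.sum_le_sum fun ω _ => h ω).trans ?_
  simp [mul_comm]

theorem unifProb_fst_le [Nonempty Ω'] (p : Ω → Prop) :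
    unifProb (fun ω : Ω × Ω' => p ω.1) ≤ unifProb p := by
  classical
  have hc : (0 : ℝ) < Fintype.card Ω' := by exact_mod_cast Fintype.card_pos
  unfold unifProb
  have : (Finset.univ.filter fun ω : Ω × Ω' => p ω.1) =
      (Finset.univ.filter p) ×ˢ (Finset.univ : Finset Ω') := by
    ext ⟨a, b⟩; simp
  rw [this, Finset.card_product, Fintype.card_prod, Finset.card_univ, Nat.cast_mul, Nat.cast_mul,
    mul_div_mul_right _ _ hc.ne']

theorem unifProb_snd_le [Nonempty Ω] (p : Ω' → Prop) :
    unifProb (fun ω : Ω × Ω' => p ω.2) ≤ unifProb p :=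
  unifProb_prod_le fun _ => le_rfl

/-- If every outcome outside the event `q` of the first seed leads to failure with probability at
most `δ` over the second seed, then `p` has probability at most `unifProb q + δ`. -/
theorem unifProb_prod_le_add [Nonempty Ω] [Nonempty Ω'] {p : Ω × Ω' → Prop} (q : Ω → Prop) {δ : ℝ}
    (hδ : 0 ≤ δ) (h : ∀ ω, ¬ q ω → unifProb (fun ω' => p (ω, ω')) ≤ δ) :
    unifProb p ≤ unifProb q + δ := by
  have h1 : unifProb p ≤ unifProb (fun ω : Ω × Ω' => q ω.1 ∨ (¬ q ω.1 ∧ p ω)) :=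
    unifProb_mono fun ω hω => by tauto
  refine h1.trans ((unifProb_or_le _ _).trans (add_le_add (unifProb_fst_le q) ?_))
  refine unifProb_prod_le fun ω => ?_
  by_cases hq : q ω
  · rw [unifProb_of_forall_not (by simp [hq])]; exact hδ
  · simpa [hq] using h ω hq

/-- The exponential-moment bound for the number of independent events that occur. The events are
indexed by `J`; the event of `x` depends on the coordinate `key x` alone, and different events
depend on different coordinates. -/
theorem unifProb_card_filter_le {ι α τ : Type} [Fintype ι] [DecidableEq ι] [Fintype α] [Nonempty α]
    (J : Finset τ) (key : τ → ι) (hkey : Set.InjOn key J) (bad : τ → α → Prop)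
    [∀ x, DecidablePred (bad x)] {p : ℝ}
    (hp : 0 ≤ p) (hbad : ∀ x ∈ J, unifProb (bad x) ≤ p) (t : ℕ) {m : ℕ} (hm : J.card ≤ m) :
    unifProb (fun ω : ι → α => t ≤ (J.filter fun x => bad x (ω (key x))).card) ≤
      (1 + p) ^ m / 2 ^ t := by
  classical
  have hα : (0 : ℝ) < Fintype.card α := by exact_mod_cast Fintype.card_pos
  set g : ι → α → ℝ := fun i a => ∏ x ∈ J.filter (key · = i), if bad x a then 2 else 1 with hg
  have hpow : ∀ ω : ι → α, (2 : ℝ) ^ (J.filter fun x => bad x (ω (key x))).card =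
      ∏ i, g i (ω i) := by
    intro ω
    rw [← Finset.prod_const, Finset.prod_filter, ← Finset.prod_fiberwise J key]
    refine Finset.prod_congr rfl fun i _ => Finset.prod_congr rfl fun x hx => ?_
    rw [(Finset.mem_filter.1 hx).2]
  have hsum : ∀ i, ∑ a, g i a ≤ Fintype.card α * (1 + p) ^ (J.filter (key · = i)).card := by
    intro i
    have hle : (J.filter (key · = i)).card ≤ 1 := by
      rw [Finset.card_le_one]
      intro x hx y hy
      simp only [Finset.mem_filter] at hx hy
      exact hkey hx.1 hy.1 (hx.2.trans hy.2.symm)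
    rcases Nat.le_one_iff_eq_zero_or_eq_one.1 hle with h | h
    · rw [h]
      rw [Finset.card_eq_zero] at h
      simp [hg, h]
    · rw [h]
      obtain ⟨x, hx⟩ := Finset.card_eq_one.1 h
      have hxJ : x ∈ J := by
        have : x ∈ J.filter (key · = i) := by rw [hx]; simp
        exact (Finset.mem_filter.1 this).1
      have hb := hbad x hxJ
      rw [unifProb_eq, div_le_iff₀ hα] at hb
      have : ∑ a, g i a = Fintype.card α + ((Finset.univ.filter (bad x)).card : ℝ) := by
        simp only [hg, hx, Finset.prod_singleton]
        have : ∀ a, (if bad x a then (2 : ℝ) else 1) = 1 + if bad x a then 1 else 0 := by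
          intro a; split_ifs <;> norm_num
        simp [this, Finset.sum_add_distrib]
      rw [this, pow_one]
      linarith
  have htot : ∑ ω : ι → α, (2 : ℝ) ^ (J.filter fun x => bad x (ω (key x))).card ≤
      Fintype.card (ι → α) * (1 + p) ^ m := by
    simp only [hpow]
    have h1 := Finset.prod_univ_sum (fun _ : ι => (Finset.univ : Finset α)) g
    rw [Fintype.piFinset_univ] at h1
    rw [← h1]
    refine (Finset.prod_le_prod (fun i _ => ?_) fun i _ => hsum i).trans ?_
    · exact Finset.sum_nonneg fun a _ => Finset.prod_nonneg fun x _ => by split_ifs <;> norm_num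
    · rw [Finset.prod_mul_distrib, Finset.prod_pow_eq_pow_sum,
        Finset.sum_card_fiberwise_eq_card_filter]
      simp only [Finset.prod_const, Finset.mem_univ, Finset.filter_true, Fintype.card_fun,
        Nat.cast_pow, Finset.card_univ]
      gcongr
      linarith
  have hΩ : (0 : ℝ) < Fintype.card (ι → α) := by exact_mod_cast Fintype.card_pos
  rw [unifProb_eq, div_le_div_iff₀ hΩ (by positivity), mul_comm ((1 + p) ^ m)]
  refine le_trans ?_ htot
  rw [← nsmul_eq_mul, ← Finset.sum_const]
  refine le_trans (Finset.sum_le_sum fun ω hω => ?_)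
    (Finset.sum_le_sum_of_subset_of_nonneg (Finset.filter_subset _ _) fun _ _ _ => by positivity)
  exact pow_le_pow_right₀ (by norm_num) (by simpa using hω)

/-- A uniform element of `Fin q` takes a given residue after an additive shift with probability
`1 / q`. -/
theorem unifProb_shift_le {q : ℕ} (j a : ℕ) :
    unifProb (fun x : Fin q => (j + x) % q = a) ≤ 1 / q := by
  classical
  unfold unifProb
  rw [Fintype.card_fin]
  gcongr
  norm_cast
  rw [Finset.card_le_one]
  intro x hx y hy
  simp only [Finset.mem_filter, Finset.mem_univ, true_and] at hx hy
  have h : j + x ≡ j + y [MOD q] := hx.trans hy.symm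
  have h2 : (x : ℕ) ≡ y [MOD q] := Nat.ModEq.add_left_cancel' j h
  have h3 := h2
  unfold Nat.ModEq at h3
  rw [Nat.mod_eq_of_lt x.2, Nat.mod_eq_of_lt y.2] at h3
  exact Fin.ext h3

end UniformProbability

/-! ### Greedy colorings -/

/-- `c` is a proper edge coloring of the finite set `F` of edges. -/
def IsProperOn {V κ : Type} (F : Finset (Sym2 V)) (c : Sym2 V → κ) : Prop :=
  ∀ e ∈ F, ∀ e' ∈ F, c e = c e' → (∃ v, v ∈ e ∧ v ∈ e') → e = e'

theorem exists_isProperOn {V : Type} [DecidableEq V] (D : ℕ) (F : Finset (Sym2 V))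
    (hdeg : ∀ v, (F.filter (v ∈ ·)).card ≤ D) :
    ∃ c : Sym2 V → Fin (2 * D + 1), IsProperOn F c := by
  induction F using Finset.induction_on with
  | empty => exact ⟨fun _ => 0, by simp [IsProperOn]⟩
  | insert e F he ih =>
    obtain ⟨c, hc⟩ := ih fun v => le_trans
      (Finset.card_le_card (Finset.filter_subset_filter _ (Finset.subset_insert _ _))) (hdeg v)
    have hle : ∀ v, (F.filter (v ∈ ·)).card ≤ D := fun v => le_trans
      (Finset.card_le_card (Finset.filter_subset_filter _ (Finset.subset_insert _ _))) (hdeg v)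
    obtain ⟨x, y, rfl⟩ : ∃ x y, e = s(x, y) := by
      induction e with | _ x y => exact ⟨x, y, rfl⟩
    obtain ⟨a, ha⟩ : ∃ a, a ∉ (F.filter (x ∈ ·)).image c ∪ (F.filter (y ∈ ·)).image c := by
      by_contra! h
      have h1 := Finset.card_le_card (fun a _ => h a : Finset.univ ⊆ _)
      rw [Finset.card_univ, Fintype.card_fin] at h1
      have h2 := Finset.card_union_le ((F.filter (x ∈ ·)).image c) ((F.filter (y ∈ ·)).image c)
      have h3 := (Finset.card_image_le (s := F.filter (x ∈ ·)) (f := c)).trans (hle x)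
      have h4 := (Finset.card_image_le (s := F.filter (y ∈ ·)) (f := c)).trans (hle y)
      omega
    have hne : ∀ e' ∈ F, e' ≠ s(x, y) := fun e' h h' => he (h' ▸ h)
    have hfree : ∀ e' ∈ F, (∃ v, v ∈ s(x, y) ∧ v ∈ e') → c e' ≠ a := by
      rintro e' he' ⟨v, hv, hv'⟩ rfl
      apply ha
      rcases Sym2.mem_iff.1 hv with rfl | rfl
      · exact Finset.mem_union_left _ (Finset.mem_image_of_mem _ (by simp [he', hv']))
      · exact Finset.mem_union_right _ (Finset.mem_image_of_mem _ (by simp [he', hv']))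
    refine ⟨Function.update c s(x, y) a, ?_⟩
    intro e₁ h₁ e₂ h₂ hcol hv
    rcases Finset.mem_insert.1 h₁ with rfl | h₁ <;> rcases Finset.mem_insert.1 h₂ with rfl | h₂
    · rfl
    · rw [Function.update_self, Function.update_of_ne (hne _ h₂)] at hcol
      exact absurd hcol.symm (hfree _ h₂ hv)
    · rw [Function.update_self, Function.update_of_ne (hne _ h₁)] at hcol
      obtain ⟨v, h, h'⟩ := hv
      exact absurd hcol (hfree _ h₁ ⟨v, h', h⟩)
    · rw [Function.update_of_ne (hne _ h₁), Function.update_of_ne (hne _ h₂)] at hcol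
      exact hc _ h₁ _ h₂ hcol hv

/-- If every window `p` is shared by at most `w` elements of `U`, and each of them has used fewer
than `w` of the `2 * w` positions, then all elements can pick unused positions in such a way that
elements with the same window pick different ones. -/
theorem exists_positions {V β : Type} [DecidableEq V] [DecidableEq β] (w : ℕ) (U : Finset V)
    (win : V → β) (used : V → Finset (Fin (2 * w))) (hw : 0 < w)
    (hused : ∀ u ∈ U, (used u).card < w)
    (hload : ∀ p, (U.filter fun u => win u = p).card ≤ w) :
    ∃ pos : V → Fin (2 * w), (∀ u ∈ U, pos u ∉ used u) ∧
      ∀ u ∈ U, ∀ u' ∈ U, win u = win u' → pos u = pos u' → u = u' := by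
  induction U using Finset.induction_on with
  | empty => exact ⟨fun _ => ⟨0, by omega⟩, by simp⟩
  | insert x U hx ih =>
    obtain ⟨pos, h1, h2⟩ := ih (fun u hu => hused u (Finset.mem_insert_of_mem hu)) fun p =>
      le_trans (Finset.card_le_card
        (Finset.filter_subset_filter _ (Finset.subset_insert _ _))) (hload p)
    obtain ⟨a, ha⟩ : ∃ a, a ∉ used x ∪ (U.filter fun u => win u = win x).image pos := by
      by_contra! h
      have h1 := Finset.card_le_card (fun a _ => h a : Finset.univ ⊆ _)
      rw [Finset.card_univ, Fintype.card_fin] at h1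
      have h2 := Finset.card_union_le (used x) ((U.filter fun u => win u = win x).image pos)
      have h3 := hused x (Finset.mem_insert_self _ _)
      have h4 := (Finset.card_image_le (s := U.filter fun u => win u = win x) (f := pos))
      have h5 := hload (win x)
      rw [Finset.filter_insert, if_pos rfl, Finset.card_insert_of_notMem (by simp [hx])] at h5
      omega
    rw [Finset.notMem_union] at ha
    have hne : ∀ u ∈ U, u ≠ x := fun u hu h => hx (h ▸ hu)
    have hfree : ∀ u ∈ U, win u = win x → pos u ≠ a := fun u hu hwin h =>
      ha.2 (Finset.mem_image.2 ⟨u, by simp [hu, hwin], h⟩)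
    refine ⟨Function.update pos x a, ?_, ?_⟩
    · intro u hu
      rcases Finset.mem_insert.1 hu with rfl | hu
      · rw [Function.update_self]; exact ha.1
      · rw [Function.update_of_ne (hne u hu)]; exact h1 u hu
    · intro u hu u' hu' hwin hpos
      rcases Finset.mem_insert.1 hu with rfl | h₁ <;> rcases Finset.mem_insert.1 hu' with rfl | h₂
      · rfl
      · rw [Function.update_self, Function.update_of_ne (hne _ h₂)] at hpos
        exact absurd hpos.symm (hfree _ h₂ hwin.symm)
      · rw [Function.update_self, Function.update_of_ne (hne _ h₁)] at hpos
        exact absurd hpos (hfree _ h₁ hwin)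
      · rw [Function.update_of_ne (hne _ h₁), Function.update_of_ne (hne _ h₂)] at hpos
        exact h2 u h₁ u' h₂ hwin hpos

/-! ### Buffering: stars and sparse batches -/

/-- What the buffer hands over to be colored: `burst v j U` is the `j`-th star with center `v`, its
set of leaves being `U`; `flush t F` is the `t`-th batch of edges without a vertex of high
degree. -/
inductive Event (V : Type)
  | burst (v : V) (j : ℕ) (U : Finset V)
  | flush (t : ℕ) (F : Finset (Sym2 V))

/-- The edges of an event. -/
noncomputable def Event.edges {V : Type} : Event V → List (Sym2 V)
  | .burst v _ U => U.toList.map fun u => s(v, u)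
  | .flush _ F => F.toList

/-- The name of an event: center and number of a star, or number of a batch. -/
def Event.key {V : Type} : Event V → (V × ℕ) ⊕ ℕ
  | .burst v j _ => .inl (v, j)
  | .flush t _ => .inr t

/-- The buffered edges, the number of batches so far, and the number of stars of each vertex. -/
structure EdgeBuffer (V : Type) where
  edges : Finset (Sym2 V)
  flushes : ℕ
  bursts : V → ℕ

namespace EdgeBuffer

variable {V : Type} [DecidableEq V]

/-- No vertex has `b` or more buffered edges. -/
def IsSparse (b : ℕ) (B : EdgeBuffer V) : Prop := ∀ v, (B.edges.filter (v ∈ ·)).card < b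

theorem card_filter_insert {F : Finset (Sym2 V)} {e : Sym2 V} (he : e ∉ F) (v : V) :
    ((insert e F).filter (v ∈ ·)).card = (F.filter (v ∈ ·)).card + if v ∈ e then 1 else 0 := by
  rw [Finset.filter_insert]
  split_ifs with h
  · rw [Finset.card_insert_of_notMem (by simp [he])]
  · simp

theorem IsSparse.of_insert {b : ℕ} {B : EdgeBuffer V} (hB : B.IsSparse b) {e : Sym2 V}
    (h : ∀ v ∈ e, ((insert e B.edges).filter (v ∈ ·)).card < b) (v : V) :
    ((insert e B.edges).filter (v ∈ ·)).card < b := by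
  by_cases hv : v ∈ e
  · exact h v hv
  · rw [Finset.filter_insert, if_neg hv]; exact hB v

variable [Fintype V]

/-- A vertex with `b` buffered edges is the center of a burst; if there is no such vertex, a buffer
with `m` edges is flushed. -/
noncomputable def push (b m : ℕ) (B : EdgeBuffer V) (e : Sym2 V) :
    EdgeBuffer V × List (Event V) :=
  open Classical in
  if h : ∃ v ∈ e, b ≤ ((insert e B.edges).filter (v ∈ ·)).card then
    (⟨(insert e B.edges).filter (h.choose ∉ ·), B.flushes,
        Function.update B.bursts h.choose (B.bursts h.choose + 1)⟩,
      [.burst h.choose (B.bursts h.choose)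
        (Finset.univ.filter fun u => s(h.choose, u) ∈ insert e B.edges)])
  else if m ≤ (insert e B.edges).card then
    (⟨∅, B.flushes + 1, B.bursts⟩, [.flush B.flushes (insert e B.edges)])
  else (⟨insert e B.edges, B.flushes, B.bursts⟩, [])

/-- The events from a given buffer on; at the end of the stream the buffer is flushed. -/
noncomputable def eventsFrom (b m : ℕ) : EdgeBuffer V → List (Sym2 V) → List (Event V)
  | B, [] => [.flush B.flushes B.edges]
  | B, e :: σ => (B.push b m e).2 ++ eventsFrom b m (B.push b m e).1 σ

/-- The initial buffer. -/
def empty : EdgeBuffer V := ⟨∅, 0, fun _ => 0⟩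

/-- The three ways in which a buffer reacts to an edge. -/
theorem push_cases (b m : ℕ) (B : EdgeBuffer V) (e : Sym2 V)
    {P : EdgeBuffer V × List (Event V) → Prop}
    (hburst : ∀ v ∈ e, b ≤ ((insert e B.edges).filter (v ∈ ·)).card →
      P (⟨(insert e B.edges).filter (v ∉ ·), B.flushes,
        Function.update B.bursts v (B.bursts v + 1)⟩,
      [.burst v (B.bursts v) (Finset.univ.filter fun u => s(v, u) ∈ insert e B.edges)]))
    (hflush : (∀ v ∈ e, ((insert e B.edges).filter (v ∈ ·)).card < b) →
      m ≤ (insert e B.edges).card →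
      P (⟨∅, B.flushes + 1, B.bursts⟩, [.flush B.flushes (insert e B.edges)]))
    (hstore : (∀ v ∈ e, ((insert e B.edges).filter (v ∈ ·)).card < b) →
      (insert e B.edges).card < m →
      P (⟨insert e B.edges, B.flushes, B.bursts⟩, [])) :
    P (B.push b m e) := by
  unfold push
  split_ifs with h1 h2
  · exact hburst _ h1.choose_spec.1 h1.choose_spec.2
  · exact hflush (by simpa using h1) h2
  · exact hstore (by simpa using h1) (by simpa using h2)

theorem IsSparse.push {b m : ℕ} {B : EdgeBuffer V} (hB : B.IsSparse b) (hb : 0 < b) {e : Sym2 V}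
    (he : e ∉ B.edges) : (B.push b m e).1.IsSparse b := by
  refine push_cases b m B e (P := fun r => r.1.IsSparse b) ?_ ?_ ?_
  · intro v hv _ x
    by_cases hx : x ∈ e
    · by_cases hxv : x = v
      · subst hxv
        simp only [Finset.filter_filter]
        rw [Finset.filter_false_of_mem (by rintro _ _ ⟨h1, h2⟩; exact h1 h2)]
        simpa using hb
      · -- the new edge contains `v`, hence has left the buffer
        refine lt_of_le_of_lt (Finset.card_le_card ?_) (hB x)
        intro f hf
        simp only [Finset.mem_filter, Finset.mem_insert] at hf ⊢
        obtain ⟨⟨rfl | hf, h1⟩, h2⟩ := hf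
        · exact absurd hv h1
        · exact ⟨hf, h2⟩
    · refine lt_of_le_of_lt (Finset.card_le_card ?_) (hB x)
      intro f hf
      simp only [Finset.mem_filter, Finset.mem_insert] at hf ⊢
      obtain ⟨⟨rfl | hf, h1⟩, h2⟩ := hf
      · exact absurd hv h1
      · exact ⟨hf, h2⟩
  · intro _ _ x
    simpa using hb
  · intro h _ x
    exact hB.of_insert h x

theorem push_subset (b m : ℕ) (B : EdgeBuffer V) (e : Sym2 V) :
    (B.push b m e).1.edges ⊆ insert e B.edges :=
  push_cases b m B e (P := fun r => r.1.edges ⊆ insert e B.edges)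
    (fun _ _ _ => Finset.filter_subset _ _) (fun _ _ => by simp) (fun _ _ => by simp)

/-- The star with center `v` and the edges not at `v`. -/
theorem star_append_perm (F : Finset (Sym2 V)) (v : V) (j : ℕ) :
    ((Event.burst v j (Finset.univ.filter fun u => s(v, u) ∈ F)).edges ++
      (F.filter (v ∉ ·)).toList).Perm F.toList := by
  have hnd : (Event.burst v j (Finset.univ.filter fun u => s(v, u) ∈ F)).edges.Nodup := by
    refine (Finset.nodup_toList _).map fun u u' h => ?_
    exact Sym2.congr_right.1 h
  rw [List.perm_ext_iff_of_nodup _ (Finset.nodup_toList _)]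
  · intro f
    simp only [Event.edges, List.mem_append, List.mem_map, Finset.mem_toList, Finset.mem_filter,
      Finset.mem_univ, true_and]
    constructor
    · rintro (⟨u, hu, rfl⟩ | ⟨h, _⟩)
      · exact hu
      · exact h
    · intro hf
      by_cases hv : v ∈ f
      · obtain ⟨u, rfl⟩ := hv
        exact Or.inl ⟨u, hf, rfl⟩
      · exact Or.inr ⟨hf, hv⟩
  · refine hnd.append (Finset.nodup_toList _) ?_
    intro f hf hf'
    simp only [Event.edges, List.mem_map, Finset.mem_toList, Finset.mem_filter] at hf hf'
    obtain ⟨u, _, rfl⟩ := hf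
    exact hf'.2 (Sym2.mem_mk_left _ _)

theorem push_perm (b m : ℕ) (B : EdgeBuffer V) {e : Sym2 V} (he : e ∉ B.edges) :
    ((B.push b m e).2.flatMap Event.edges ++ (B.push b m e).1.edges.toList).Perm
      (e :: B.edges.toList) := by
  have hins : (insert e B.edges).toList.Perm (e :: B.edges.toList) := Finset.toList_insert he
  refine push_cases b m B e
    (P := fun r => (r.2.flatMap Event.edges ++ r.1.edges.toList).Perm (e :: B.edges.toList)) ?_ ?_ ?_
  · intro v _ _
    simpa using (star_append_perm (insert e B.edges) v (B.bursts v)).trans hins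
  · intro _ _
    simpa [Event.edges] using hins
  · intro _ _
    simpa using hins

/-- Every edge of the buffer and of the stream belongs to exactly one event. -/
theorem eventsFrom_perm (b m : ℕ) (σ : List (Sym2 V)) (B : EdgeBuffer V) (hσ : σ.Nodup)
    (hdisj : ∀ e ∈ σ, e ∉ B.edges) :
    ((eventsFrom b m B σ).flatMap Event.edges).Perm (B.edges.toList ++ σ) := by
  induction σ generalizing B with
  | nil => simp [eventsFrom, Event.edges]
  | cons e σ ih =>
    have he := hdisj e List.mem_cons_self
    rw [List.nodup_cons] at hσ
    simp only [eventsFrom, List.flatMap_append]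
    refine (List.Perm.append_left _ (ih (B.push b m e).1 hσ.2 ?_)).trans ?_
    · intro f hf hf'
      rcases Finset.mem_insert.1 (push_subset b m B e hf') with rfl | h
      · exact hσ.1 hf
      · exact hdisj f (List.mem_cons_of_mem _ hf) h
    · rw [← List.append_assoc]
      refine (List.Perm.append_right σ (push_perm b m B he)).trans ?_
      exact List.perm_middle.symm

/-- The counters of later events are at least the present ones, and they are bounded: a burst uses
up at least `b` edges at its center, and a flush before the end uses up at least `m` edges. -/
def Bounded (b m : ℕ) (B : EdgeBuffer V) (σ : List (Sym2 V)) : Event V → Prop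
  | .burst v j U => B.bursts v ≤ j ∧ U.card ≤ b ∧ b * (j + 1) ≤
      b * B.bursts v + (B.edges.filter (v ∈ ·)).card + (σ.filter (v ∈ ·)).length
  | .flush t F => B.flushes ≤ t ∧ (∀ v, (F.filter (v ∈ ·)).card < b) ∧
      m * t ≤ m * B.flushes + B.edges.card + σ.length

theorem card_star_le (F : Finset (Sym2 V)) (v : V) :
    (Finset.univ.filter fun u => s(v, u) ∈ F).card ≤ (F.filter (v ∈ ·)).card := by
  refine Finset.card_le_card_of_injOn (fun u => s(v, u)) ?_ ?_
  · intro u hu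
    simpa using hu
  · intro u _ u' _ h
    exact Sym2.congr_right.1 h

theorem bounded_of_mem_eventsFrom {b m : ℕ} (hb : 0 < b) (σ : List (Sym2 V)) (B : EdgeBuffer V)
    (hσ : σ.Nodup) (hdisj : ∀ e ∈ σ, e ∉ B.edges) (hB : B.IsSparse b) :
    ∀ x ∈ eventsFrom b m B σ, B.Bounded b m σ x := by
  induction σ generalizing B with
  | nil =>
    intro x hx
    simp only [eventsFrom, List.mem_singleton] at hx
    subst hx
    exact ⟨le_rfl, hB, by simp⟩
  | cons e σ ih =>
    have he := hdisj e List.mem_cons_self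
    rw [List.nodup_cons] at hσ
    intro x hx
    simp only [eventsFrom, List.mem_append] at hx
    have ih' := ih (B.push b m e).1 hσ.2 (by
      intro f hf hf'
      rcases Finset.mem_insert.1 (push_subset b m B e hf') with rfl | h
      · exact hσ.1 hf
      · exact hdisj f (List.mem_cons_of_mem _ hf) h) (hB.push hb he) x
    have hlen : ∀ v, ((e :: σ).filter (v ∈ ·)).length =
        (σ.filter (v ∈ ·)).length + if v ∈ e then 1 else 0 := by
      intro v
      by_cases hv : v ∈ e <;> simp [hv]
    have hins := card_filter_insert he
    revert hx ih'
    refine push_cases b m B e (P := fun r => (x ∈ r.2 ∨ x ∈ eventsFrom b m r.1 σ) →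
      (x ∈ eventsFrom b m r.1 σ → r.1.Bounded b m σ x) → B.Bounded b m (e :: σ) x) ?_ ?_ ?_
    · intro v hv hdeg hx ih'
      have hcard : (insert e B.edges).card = B.edges.card + 1 := Finset.card_insert_of_notMem he
      rcases hx with hx | hx
      · rw [List.mem_singleton] at hx
        subst hx
        refine ⟨le_rfl, (card_star_le _ _).trans ?_, ?_⟩
        · have := hB v
          rw [hins, if_pos hv]
          omega
        · rw [hlen, if_pos hv, mul_add]
          rw [hins, if_pos hv] at hdeg
          omega
      · have h := ih' hx
        cases x with
        | burst x j U =>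
          obtain ⟨h1, h2, h3⟩ := h
          refine ⟨?_, h2, ?_⟩
          · refine le_trans ?_ h1
            by_cases hxv : x = v
            · subst hxv; simp
            · simp [hxv]
          · by_cases hxv : x = v
            · subst hxv
              have hz : (((insert e B.edges).filter (x ∉ ·)).filter (x ∈ ·)).card = 0 := by
                rw [Finset.card_eq_zero, Finset.filter_filter]
                exact Finset.filter_false_of_mem (by rintro _ _ ⟨h1, h2⟩; exact h1 h2)
              simp only [Function.update_self] at h3
              rw [hz, mul_add b (B.bursts x)] at h3
              rw [hlen]
              have := hins x
              omega
            · simp only [Function.update_of_ne hxv] at h3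
              have hle : (((insert e B.edges).filter (v ∉ ·)).filter (x ∈ ·)).card ≤
                  ((insert e B.edges).filter (x ∈ ·)).card :=
                Finset.card_le_card (Finset.filter_subset_filter _ (Finset.filter_subset _ _))
              rw [hlen]
              have := hins x
              omega
        | flush t F =>
          obtain ⟨h1, h2, h3⟩ := h
          refine ⟨h1, h2, h3.trans ?_⟩
          have hle := Finset.card_filter_le (insert e B.edges) (v ∉ ·)
          simp only [List.length_cons]
          omega
    · intro hdeg hm hx ih'
      have hcard : (insert e B.edges).card = B.edges.card + 1 := Finset.card_insert_of_notMem he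
      rcases hx with hx | hx
      · rw [List.mem_singleton] at hx
        subst hx
        exact ⟨le_rfl, hB.of_insert hdeg, by omega⟩
      · have h := ih' hx
        cases x with
        | burst x j U =>
          obtain ⟨h1, h2, h3⟩ := h
          refine ⟨h1, h2, ?_⟩
          simp only [Finset.filter_empty, Finset.card_empty] at h3
          rw [hlen]
          omega
        | flush t F =>
          obtain ⟨h1, h2, h3⟩ := h
          refine ⟨le_trans (Nat.le_succ _) h1, h2, ?_⟩
          simp only [Finset.card_empty, mul_add, mul_one] at h3
          simp only [List.length_cons]
          omega
    · intro hdeg hm hx ih'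
      have hcard : (insert e B.edges).card = B.edges.card + 1 := Finset.card_insert_of_notMem he
      rcases hx with hx | hx
      · simp at hx
      · have h := ih' hx
        cases x with
        | burst x j U =>
          obtain ⟨h1, h2, h3⟩ := h
          refine ⟨h1, h2, ?_⟩
          simp only at h3
          rw [hlen]
          have := hins x
          omega
        | flush t F =>
          obtain ⟨h1, h2, h3⟩ := h
          refine ⟨h1, h2, ?_⟩
          simp only [hcard] at h3
          simp only [List.length_cons]
          omega

theorem eventsFrom_key_nodup {b m : ℕ} (hb : 0 < b) (σ : List (Sym2 V)) (B : EdgeBuffer V)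
    (hσ : σ.Nodup) (hdisj : ∀ e ∈ σ, e ∉ B.edges) (hB : B.IsSparse b) :
    ((eventsFrom b m B σ).map Event.key).Nodup := by
  induction σ generalizing B with
  | nil => simp [eventsFrom]
  | cons e σ ih =>
    have he := hdisj e List.mem_cons_self
    rw [List.nodup_cons] at hσ
    have hdisj' : ∀ f ∈ σ, f ∉ (B.push b m e).1.edges := by
      intro f hf hf'
      rcases Finset.mem_insert.1 (push_subset b m B e hf') with rfl | h
      · exact hσ.1 hf
      · exact hdisj f (List.mem_cons_of_mem _ hf) h
    have ih' := ih (B.push b m e).1 hσ.2 hdisj' (hB.push hb he)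
    have hbd := bounded_of_mem_eventsFrom (m := m) hb σ _ hσ.2 hdisj' (hB.push hb he)
    simp only [eventsFrom]
    revert ih' hbd
    refine push_cases b m B e (P := fun r => ((eventsFrom b m r.1 σ).map Event.key).Nodup →
      (∀ x ∈ eventsFrom b m r.1 σ, r.1.Bounded b m σ x) →
      ((r.2 ++ eventsFrom b m r.1 σ).map Event.key).Nodup) ?_ ?_ ?_
    · intro v hv _ ih' hbd
      rw [List.singleton_append, List.map_cons, List.nodup_cons]
      refine ⟨?_, ih'⟩
      rw [List.mem_map]
      rintro ⟨x, hx, hkey⟩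
      have h := hbd x hx
      cases x with
      | burst x j U =>
        simp only [Event.key, Sum.inl.injEq, Prod.mk.injEq] at hkey
        obtain ⟨rfl, rfl⟩ := hkey
        have := h.1
        simp at this
      | flush t F => simp [Event.key] at hkey
    · intro _ _ ih' hbd
      rw [List.singleton_append, List.map_cons, List.nodup_cons]
      refine ⟨?_, ih'⟩
      rw [List.mem_map]
      rintro ⟨x, hx, hkey⟩
      have h := hbd x hx
      cases x with
      | burst x j U => simp [Event.key] at hkey
      | flush t F =>
        simp only [Event.key, Sum.inr.injEq] at hkey
        subst hkey
        have := h.1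
        simp at this
    · intro _ _ ih' _
      exact ih'

end EdgeBuffer

/-! ### Coloring stars and batches -/

/-- The palette: one part for the batches, the other one for the stars. A color of a star consists
of the side of its center, the class and the group of the star, and a position in one of `P` windows
of `2 * w` positions. -/
abbrev EventColor (b q h P w T : ℕ) : Type :=
  (Fin T × Fin (2 * b + 1)) ⊕ (Bool × Fin q × Fin h × Fin P × Fin (2 * w))

/-- For every leaf `u` and every class: the number of edges that `u` has received in this class,
and the positions that `u` has used in its current window. -/
structure LeafState (V : Type) (q w : ℕ) where
  count : V → Fin q → ℕ
  used : V → Fin q → Finset (Fin (2 * w))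

section Coloring

variable {V : Type} {q P : ℕ}

/-- The class of the `j`-th star of `v`; `ρ` shifts the classes at random. -/
def starClass (ρ : V → Fin q) (v : V) (j : ℕ) : Fin q :=
  ⟨(j + ρ v) % q, Nat.mod_lt _ (Fin.pos (ρ v))⟩

/-- The window of `u` in class `a` after `k` edges; every window serves `w` edges, and `r` shifts
the windows at random. -/
def leafWindow (r : V × Fin q → Fin P) (w : ℕ) (u : V) (a : Fin q) (k : ℕ) : Fin P :=
  ⟨(k / w + r (u, a)) % P, Nat.mod_lt _ (Fin.pos (r (u, a)))⟩

/-- Before it has received `P * w` edges, a leaf never returns to an earlier window. -/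
theorem leafWindow_eq_iff {r : V × Fin q → Fin P} {w : ℕ} {u : V} {a : Fin q} {k k' : ℕ}
    (hk : k < P * w) (hk' : k' < P * w) :
    leafWindow r w u a k = leafWindow r w u a k' ↔ k / w = k' / w := by
  have h1 : k / w < P := Nat.div_lt_of_lt_mul (by rwa [mul_comm])
  have h2 : k' / w < P := Nat.div_lt_of_lt_mul (by rwa [mul_comm])
  constructor
  · intro h
    have h3 : k / w + r (u, a) ≡ k' / w + r (u, a) [MOD P] := by
      simpa [leafWindow, Nat.ModEq] using h
    have h4 := Nat.ModEq.add_right_cancel' _ h3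
    unfold Nat.ModEq at h4
    rwa [Nat.mod_eq_of_lt h1, Nat.mod_eq_of_lt h2] at h4
  · intro h
    simp [leafWindow, h]

/-- Class and group determine the star of a given center. -/
theorem starClass_injOn {ρ : V → Fin q} {v : V} {j j' : ℕ}
    (h : starClass ρ v j = starClass ρ v j') (hdiv : j / q = j' / q) : j = j' := by
  have h3 : j + ρ v ≡ j' + ρ v [MOD q] := by simpa [starClass, Nat.ModEq] using h
  have h4 : j % q = j' % q := Nat.ModEq.add_right_cancel' _ h3
  rw [← Nat.div_add_mod j q, ← Nat.div_add_mod j' q, hdiv, h4]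

/-- The event is a star of class `a` with leaf `u`. -/
def Event.Hits (ρ : V → Fin q) (u : V) (a : Fin q) : Event V → Prop
  | .burst v j U => u ∈ U ∧ starClass ρ v j = a
  | .flush _ _ => False

theorem Event.hits_burst {ρ : V → Fin q} {u : V} {a : Fin q} {v : V} {j : ℕ} {U : Finset V} :
    (Event.burst v j U).Hits ρ u a ↔ u ∈ U ∧ starClass ρ v j = a := Iff.rfl

theorem Event.not_hits_flush {ρ : V → Fin q} {u : V} {a : Fin q} {t : ℕ} {F : Finset (Sym2 V)} :
    ¬ (Event.flush t F).Hits ρ u a := id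

variable [DecidableEq V]

instance (ρ : V → Fin q) (u : V) (a : Fin q) : DecidablePred (Event.Hits ρ u a)
  | .burst v j U => inferInstanceAs (Decidable (u ∈ U ∧ starClass ρ v j = a))
  | .flush _ _ => inferInstanceAs (Decidable False)

/-- The number of stars of class `a` with leaf `u`. -/
def load (ρ : V → Fin q) (E : List (Event V)) (u : V) (a : Fin q) : ℕ :=
  E.countP fun x => decide (x.Hits ρ u a)

/-- `pos` gives every leaf an unused position, and different ones to leaves with the same
window. -/
def IsPlacement {w : ℕ} (U : Finset V) (win : V → Fin P) (used : V → Finset (Fin (2 * w)))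
    (pos : V → Fin (2 * w)) : Prop :=
  (∀ u ∈ U, pos u ∉ used u) ∧ ∀ u ∈ U, ∀ u' ∈ U, win u = win u' → pos u = pos u' → u = u'

variable {b h w T : ℕ}

theorem eq_of_finOfNat_eq {N a c : ℕ} [NeZero N] (ha : a < N) (hc : c < N)
    (h : Fin.ofNat N a = Fin.ofNat N c) : a = c := by
  have := congrArg Fin.val h
  simpa [Fin.ofNat, Nat.mod_eq_of_lt ha, Nat.mod_eq_of_lt hc] using this

/-- What the analysis needs to know about the events: their names differ, their numbers fit into
the palette, the edges of the stars cross the bipartition, and the batches have small degrees. -/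
structure IsEventList (side : V → Bool) (b q h T : ℕ) (E : List (Event V)) : Prop where
  key_nodup : (E.map Event.key).Nodup
  group_lt : ∀ v j U, Event.burst v j U ∈ E → j / q < h
  crossing : ∀ v j U, Event.burst v j U ∈ E → ∀ u ∈ U, side u ≠ side v
  flush_lt : ∀ t F, Event.flush t F ∈ E → t < T
  flush_degree : ∀ t F, Event.flush t F ∈ E → ∀ v, (F.filter (v ∈ ·)).card ≤ b

theorem IsEventList.of_append {side : V → Bool} {E E' : List (Event V)}
    (hE : IsEventList side b q h T (E ++ E')) : IsEventList side b q h T E where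
  key_nodup := by
    have := hE.key_nodup
    rw [List.map_append] at this
    exact this.of_append_left
  group_lt v j U hm := hE.group_lt v j U (List.mem_append_left _ hm)
  crossing v j U hm := hE.crossing v j U (List.mem_append_left _ hm)
  flush_lt v j hm := hE.flush_lt v j (List.mem_append_left _ hm)
  flush_degree v j hm := hE.flush_degree v j (List.mem_append_left _ hm)

/-- The seeds are good for the events: no leaf runs out of windows in any class, and in no star do
more than `w` leaves share a window. -/
structure IsGoodSeed (w : ℕ) (ρ : V → Fin q) (r : V × Fin q → Fin P) (E : List (Event V)) :
    Prop where
  load_le : ∀ u a, load ρ E u a ≤ P * w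
  spread : ∀ pre v j U post, E = pre ++ .burst v j U :: post → ∀ p,
    (U.filter fun u => leafWindow r w u (starClass ρ v j)
      (load ρ pre u (starClass ρ v j)) = p).card ≤ w

/-- The initial state. -/
def LeafState.empty : LeafState V q w := ⟨fun _ _ => 0, fun _ _ => ∅⟩

/-- The state after a star with leaves `U` in class `a`, colored with the positions `pos`. A leaf
whose window is full forgets the positions that it has used. -/
def LeafState.serve (st : LeafState V q w) (U : Finset V) (a : Fin q) (pos : V → Fin (2 * w)) :
    LeafState V q w where
  count u a' := if u ∈ U ∧ a' = a then st.count u a' + 1 else st.count u a'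
  used u a' := if u ∈ U ∧ a' = a then
      (if (st.count u a' + 1) % w = 0 then ∅ else insert (pos u) (st.used u a'))
    else st.used u a'

variable [NeZero h] [NeZero T]

/-- Where a reported color comes from. For the color of a star edge, the number `k` is the number of
edges that the leaf had received before. -/
def ColorOrigin (side : V → Bool) (ρ : V → Fin q) (r : V × Fin q → Fin P) (E : List (Event V))
    (st : LeafState V q w) (x : Sym2 V × EventColor b q h P w T) : Prop :=
  (∃ t F c, Event.flush t F ∈ E ∧ x.2 = .inl (Fin.ofNat T t, c)) ∨
  ∃ v j U u k i, Event.burst v j U ∈ E ∧ u ∈ U ∧ x.1 = s(v, u) ∧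
    x.2 = .inr (side v, starClass ρ v j, Fin.ofNat h (j / q),
      leafWindow r w u (starClass ρ v j) k, i) ∧
    k < st.count u (starClass ρ v j) ∧
    (k / w = st.count u (starClass ρ v j) / w → i ∈ st.used u (starClass ρ v j))

/-- A color used in a window that is still current is remembered; emptying the memory of a leaf
is harmless since its window changes at the same time. -/
theorem ColorOrigin.serve {side : V → Bool} {ρ : V → Fin q} {r : V × Fin q → Fin P}
    {E : List (Event V)} {st : LeafState V q w} {x : Sym2 V × EventColor b q h P w T}
    (hx : ColorOrigin side ρ r E st x) (U : Finset V) (a : Fin q) (pos : V → Fin (2 * w))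
    (e : Event V) : ColorOrigin side ρ r (E ++ [e]) (st.serve U a pos) x := by
  rcases hx with ⟨t, F, c, h1, h2⟩ | ⟨v, j, U', u, k, i, h1, h2, h3, h4, h5, h6⟩
  · exact Or.inl ⟨t, F, c, List.mem_append_left _ h1, h2⟩
  · refine Or.inr ⟨v, j, U', u, k, i, List.mem_append_left _ h1, h2, h3, h4, ?_, ?_⟩
    · simp only [LeafState.serve]
      split_ifs <;> omega
    · simp only [LeafState.serve]
      split_ifs with hu hm
      · intro hk
        have h7 : k / w ≤ st.count u (starClass ρ v j) / w := Nat.div_le_div_right h5.le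
        rw [hk, Nat.succ_div, if_pos (Nat.dvd_of_mod_eq_zero hm)] at h7
        omega
      · intro hk
        rw [Nat.succ_div, if_neg (fun hd => hm (Nat.mod_eq_zero_of_dvd hd)), add_zero] at hk
        exact Finset.mem_insert_of_mem (h6 hk)
      · exact h6

variable [NeZero w]

open Classical in
/-- A placement if there is one. -/
noncomputable def place (U : Finset V) (win : V → Fin P) (used : V → Finset (Fin (2 * w))) :
    V → Fin (2 * w) :=
  if hex : ∃ pos, IsPlacement U win used pos then hex.choose
  else fun _ => ⟨0, by have := NeZero.pos w; omega⟩

open Classical in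
/-- A proper coloring of a batch if there is one. -/
noncomputable def batchColor (b : ℕ) (F : Finset (Sym2 V)) : Sym2 V → Fin (2 * b + 1) :=
  if hex : ∃ c : Sym2 V → Fin (2 * b + 1), IsProperOn F c then hex.choose else fun _ => 0

theorem batchColor_isProperOn {D : ℕ} {F : Finset (Sym2 V)}
    (hF : ∀ v, (F.filter (v ∈ ·)).card ≤ D) : IsProperOn F (batchColor D F) := by
  have hex := exists_isProperOn D F hF
  unfold batchColor
  rw [dif_pos hex]
  exact hex.choose_spec

/-- The positions of the leaves of a star. -/
noncomputable def starPos (ρ : V → Fin q) (r : V × Fin q → Fin P) (st : LeafState V q w) (v : V)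
    (j : ℕ) (U : Finset V) : V → Fin (2 * w) :=
  place U (fun u => leafWindow r w u (starClass ρ v j) (st.count u (starClass ρ v j)))
    fun u => st.used u (starClass ρ v j)

/-- Colors one event. -/
noncomputable def colorEvent (side : V → Bool) (ρ : V → Fin q) (r : V × Fin q → Fin P)
    (st : LeafState V q w) : Event V → LeafState V q w × List (Sym2 V × EventColor b q h P w T)
  | .burst v j U => (st.serve U (starClass ρ v j) (starPos ρ r st v j U),
      U.toList.map fun u => (s(v, u), .inr (side v, starClass ρ v j, Fin.ofNat h (j / q),
        leafWindow r w u (starClass ρ v j) (st.count u (starClass ρ v j)),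
        starPos ρ r st v j U u)))
  | .flush t F => (st, F.toList.map fun e => (e, .inl (Fin.ofNat T t, batchColor b F e)))

theorem colorEvent_count_le (side : V → Bool) (ρ : V → Fin q) (r : V × Fin q → Fin P)
    (st : LeafState V q w) (x : Event V) (u : V) (a : Fin q) :
    (colorEvent (b := b) (h := h) (T := T) side ρ r st x).1.count u a ≤ st.count u a + 1 := by
  cases x with
  | burst v j U =>
    simp only [colorEvent, LeafState.serve]
    split_ifs <;> omega
  | flush t F => exact Nat.le_succ _

/-- Colors a list of events one after the other. -/
noncomputable def colorEvents (side : V → Bool) (ρ : V → Fin q) (r : V × Fin q → Fin P) :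
    LeafState V q w → List (Event V) → LeafState V q w × List (Sym2 V × EventColor b q h P w T)
  | st, [] => (st, [])
  | st, x :: E => ((colorEvents side ρ r (colorEvent (b := b) (h := h) (T := T) side ρ r st x).1 E).1,
      (colorEvent side ρ r st x).2 ++ (colorEvents side ρ r
        (colorEvent (b := b) (h := h) (T := T) side ρ r st x).1 E).2)

theorem colorEvents_append (side : V → Bool) (ρ : V → Fin q) (r : V × Fin q → Fin P)
    (st : LeafState V q w) (E E' : List (Event V)) :
    colorEvents (b := b) (h := h) (T := T) side ρ r st (E ++ E') =
      ((colorEvents (b := b) (h := h) (T := T) side ρ r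
          (colorEvents (b := b) (h := h) (T := T) side ρ r st E).1 E').1,
        (colorEvents side ρ r st E).2 ++ (colorEvents side ρ r
          (colorEvents (b := b) (h := h) (T := T) side ρ r st E).1 E').2) := by
  induction E generalizing st with
  | nil => simp [colorEvents]
  | cons x E ih => simp [colorEvents, ih]

/-- The invariant of the coloring of the events. -/
structure ColoringInvariant (side : V → Bool) (ρ : V → Fin q) (r : V × Fin q → Fin P)
    (E : List (Event V)) (st : LeafState V q w) (out : List (Sym2 V × EventColor b q h P w T)) :
    Prop where
  count_eq : ∀ u a, st.count u a = load ρ E u a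
  used_card : ∀ u a, (st.used u a).card ≤ st.count u a % w
  map_fst : out.map Prod.fst = E.flatMap Event.edges
  origin : ∀ x ∈ out, ColorOrigin side ρ r E st x
  proper : ∀ x ∈ out, ∀ y ∈ out, x.2 = y.2 → (∃ v, v ∈ x.1 ∧ v ∈ y.1) → x.1 = y.1

/-- The invariant survives a star: the load bound makes earlier windows of a leaf differ from its
current one, and the spread bound makes the greedy choice of positions possible. -/
theorem ColoringInvariant.burst {side : V → Bool} {ρ : V → Fin q} {r : V × Fin q → Fin P}
    {E : List (Event V)} {st : LeafState V q w} {out : List (Sym2 V × EventColor b q h P w T)}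
    {v : V} {j : ℕ} {U : Finset V}
    (hI : ColoringInvariant side ρ r E st out)
    (hE : IsEventList side b q h T (E ++ [.burst v j U]))
    (hload : ∀ u a, load ρ (E ++ [.burst v j U]) u a ≤ P * w)
    (hspread : ∀ p, (U.filter fun u => leafWindow r w u (starClass ρ v j)
      (load ρ E u (starClass ρ v j)) = p).card ≤ w) :
    ColoringInvariant side ρ r (E ++ [.burst v j U])
      (colorEvent (b := b) (h := h) (T := T) side ρ r st (.burst v j U)).1
      (out ++ (colorEvent side ρ r st (.burst v j U)).2) := by
  have hw : 0 < w := NeZero.pos w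
  have hmem : Event.burst v j U ∈ E ++ [Event.burst v j U] := by simp
  set a := starClass ρ v j with ha
  have hlt : ∀ u ∈ U, st.count u a < P * w := by
    intro u hu
    have h1 := hload u a
    rw [load, List.countP_append, List.countP_singleton, if_pos (by simp [Event.hits_burst, hu, ha])] at h1
    rw [hI.count_eq, load]
    omega
  have hplace : IsPlacement U (fun u => leafWindow r w u a (st.count u a)) (fun u => st.used u a)
      (starPos ρ r st v j U) := by
    have hex : ∃ pos, IsPlacement U (fun u => leafWindow r w u a (st.count u a))
        (fun u => st.used u a) pos := by
      refine exists_positions w U _ _ hw ?_ ?_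
      · intro u _
        exact lt_of_le_of_lt (hI.used_card u a) (Nat.mod_lt _ hw)
      · intro p
        simpa only [hI.count_eq] using hspread p
    unfold starPos place
    rw [← ha, dif_pos hex]
    exact hex.choose_spec
  -- a new edge and an old one
  have hnewold : ∀ u ∈ U, ∀ y ∈ out, (.inr (side v, a, Fin.ofNat h (j / q),
      leafWindow r w u a (st.count u a), starPos ρ r st v j U u) : EventColor b q h P w T) = y.2 →
      (∃ z, z ∈ s(v, u) ∧ z ∈ y.1) → False := by
    rintro u hu y hy hcol ⟨z, hz, hz'⟩
    rcases hI.origin y hy with ⟨t, F, c, _, h2⟩ | ⟨v', j', U', u', k, i, h1, h2, h3, h4, h5, h6⟩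
    · rw [h2] at hcol; simp at hcol
    · rw [h4] at hcol
      simp only [Sum.inr.injEq, Prod.mk.injEq] at hcol
      obtain ⟨c1, c2, c3, c4, c5⟩ := hcol
      have hmem' : Event.burst v' j' U' ∈ E ++ [Event.burst v j U] := List.mem_append_left _ h1
      have s1 := hE.crossing _ _ _ hmem u hu
      have s2 := hE.crossing _ _ _ hmem' u' h2
      rw [h3] at hz'
      rcases Sym2.mem_iff.1 hz with rfl | rfl <;> rcases Sym2.mem_iff.1 hz' with rfl | rfl
      · have hj : j / q = j' / q :=
          eq_of_finOfNat_eq (hE.group_lt _ _ _ hmem) (hE.group_lt _ _ _ hmem') c3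
        have hjj : j = j' := starClass_injOn c2 hj
        subst hjj
        have hk := hE.key_nodup
        rw [List.map_append, List.nodup_append] at hk
        exact hk.2.2 (.inl (z, j)) (List.mem_map.2 ⟨_, h1, rfl⟩) _ (by simp [Event.key]) rfl
      · exact s2 c1
      · exact s1 c1.symm
      · rw [← c2] at h5 h6 c4
        rw [leafWindow_eq_iff (hlt _ hu) (h5.trans (hlt _ hu))] at c4
        have := h6 c4.symm
        rw [← c5] at this
        exact hplace.1 _ hu this
  refine ⟨?_, ?_, ?_, ?_, ?_⟩
  · intro u a'
    rw [load, List.countP_append, List.countP_singleton]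
    have := hI.count_eq u a'
    rw [load] at this
    simp only [colorEvent, LeafState.serve, Event.hits_burst, decide_eq_true_eq, ← this, ← ha,
      eq_comm (a := a)]
    split_ifs <;> simp
  · intro u a'
    have := hI.used_card u a'
    simp only [colorEvent, LeafState.serve]
    split_ifs with h1 h2
    · simp
    · refine (Finset.card_insert_le _ _).trans ?_
      have h3 := @Nat.succ_div (st.count u a') w
      rw [if_neg (fun hd => h2 (Nat.mod_eq_zero_of_dvd hd)), add_zero] at h3
      have h4 := Nat.div_add_mod (st.count u a' + 1) w
      have h5 := Nat.div_add_mod (st.count u a') w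
      rw [h3] at h4
      omega
    · exact this
  · rw [List.map_append, List.flatMap_append, hI.map_fst]
    simp [colorEvent, Event.edges, Function.comp_def]
  · intro x hx
    rcases List.mem_append.1 hx with hx | hx
    · exact (hI.origin x hx).serve _ _ _ _
    · obtain ⟨u, hu, rfl⟩ := List.mem_map.1 hx
      rw [Finset.mem_toList] at hu
      refine Or.inr ⟨v, j, U, u, st.count u a, starPos ρ r st v j U u, hmem, hu, rfl, rfl, ?_, ?_⟩
      · simp [colorEvent, LeafState.serve, hu, ← ha]
      · simp only [colorEvent, LeafState.serve, hu, ← ha, and_self, if_true]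
        intro hk
        rw [Nat.succ_div] at hk
        split_ifs with hm
        · rw [if_pos (Nat.dvd_of_mod_eq_zero hm)] at hk
          omega
        · exact Finset.mem_insert_self _ _
  · intro x hx y hy hc hz
    rcases List.mem_append.1 hx with hx | hx <;> rcases List.mem_append.1 hy with hy | hy
    · exact hI.proper x hx y hy hc hz
    · obtain ⟨u, hu, rfl⟩ := List.mem_map.1 hy
      rw [Finset.mem_toList] at hu
      obtain ⟨z, h1, h2⟩ := hz
      exact (hnewold u hu x hx hc.symm ⟨z, h2, h1⟩).elim
    · obtain ⟨u, hu, rfl⟩ := List.mem_map.1 hx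
      rw [Finset.mem_toList] at hu
      exact (hnewold u hu y hy hc hz).elim
    · obtain ⟨u, hu, rfl⟩ := List.mem_map.1 hx
      obtain ⟨u', hu', rfl⟩ := List.mem_map.1 hy
      rw [Finset.mem_toList] at hu hu'
      simp only [Sum.inr.injEq, Prod.mk.injEq] at hc
      have := hplace.2 u hu u' hu' hc.2.2.2.1 hc.2.2.2.2
      rw [this]

theorem ColoringInvariant.flush {side : V → Bool} {ρ : V → Fin q} {r : V × Fin q → Fin P}
    {E : List (Event V)} {st : LeafState V q w} {out : List (Sym2 V × EventColor b q h P w T)}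
    {t : ℕ} {F : Finset (Sym2 V)}
    (hI : ColoringInvariant side ρ r E st out)
    (hE : IsEventList side b q h T (E ++ [.flush t F])) :
    ColoringInvariant side ρ r (E ++ [.flush t F])
      (colorEvent (b := b) (h := h) (T := T) side ρ r st (.flush t F)).1
      (out ++ (colorEvent side ρ r st (.flush t F)).2) := by
  have hmem : Event.flush t F ∈ E ++ [Event.flush t F] := by simp
  have hproper : IsProperOn F (batchColor b F) :=
    batchColor_isProperOn (hE.flush_degree _ _ hmem)
  have hnewold : ∀ e, ∀ y ∈ out,
      (.inl (Fin.ofNat T t, batchColor b F e) : EventColor b q h P w T) ≠ y.2 := by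
    intro e y hy hcol
    rcases hI.origin y hy with ⟨t', F', c, h1, h2⟩ | ⟨v', j', U', u', k, i, h1, h2, h3, h4, h5, h6⟩
    · rw [h2] at hcol
      simp only [Sum.inl.injEq, Prod.mk.injEq] at hcol
      have htt : t = t' := eq_of_finOfNat_eq (hE.flush_lt _ _ hmem)
        (hE.flush_lt _ _ (List.mem_append_left _ h1)) hcol.1
      subst htt
      have hk := hE.key_nodup
      rw [List.map_append, List.nodup_append] at hk
      exact hk.2.2 (.inr t) (List.mem_map.2 ⟨_, h1, rfl⟩) _ (by simp [Event.key]) rfl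
    · rw [h4] at hcol; simp at hcol
  refine ⟨?_, hI.used_card, ?_, ?_, ?_⟩
  · intro u a'
    rw [load, List.countP_append, List.countP_singleton]
    have := hI.count_eq u a'
    rw [load] at this
    simp [colorEvent, Event.not_hits_flush, ← this]
  · rw [List.map_append, List.flatMap_append, hI.map_fst]
    simp [colorEvent, Event.edges, Function.comp_def]
  · intro x hx
    rcases List.mem_append.1 hx with hx | hx
    · rcases hI.origin x hx with ⟨t, F, c, h1, h2⟩ | ⟨v, j, U', u, k, i, h1, h2⟩
      · exact Or.inl ⟨t, F, c, List.mem_append_left _ h1, h2⟩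
      · exact Or.inr ⟨v, j, U', u, k, i, List.mem_append_left _ h1, h2⟩
    · obtain ⟨e, he, rfl⟩ := List.mem_map.1 hx
      exact Or.inl ⟨t, F, _, hmem, rfl⟩
  · intro x hx y hy hc hz
    rcases List.mem_append.1 hx with hx | hx <;> rcases List.mem_append.1 hy with hy | hy
    · exact hI.proper x hx y hy hc hz
    · obtain ⟨e, he, rfl⟩ := List.mem_map.1 hy
      exact absurd hc.symm (hnewold e x hx)
    · obtain ⟨e, he, rfl⟩ := List.mem_map.1 hx
      exact absurd hc (hnewold e y hy)
    · obtain ⟨e, he, rfl⟩ := List.mem_map.1 hx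
      obtain ⟨e', he', rfl⟩ := List.mem_map.1 hy
      rw [Finset.mem_toList] at he he'
      simp only [Sum.inl.injEq, Prod.mk.injEq] at hc
      exact hproper e he e' he' hc.2 hz

/-- With good seeds, all events together are properly colored. -/
theorem colorEvents_isProperReport {side : V → Bool} {ρ : V → Fin q} {r : V × Fin q → Fin P}
    {E : List (Event V)} (hE : IsEventList side b q h T E) (hG : IsGoodSeed w ρ r E) :
    IsProperReport (E.flatMap Event.edges)
      (colorEvents (b := b) (h := h) (w := w) (T := T) side ρ r LeafState.empty E).2 := by
  have key : ∀ pre post, E = pre ++ post → ColoringInvariant side ρ r pre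
      (colorEvents (b := b) (h := h) (w := w) (T := T) side ρ r LeafState.empty pre).1
      (colorEvents (b := b) (h := h) (w := w) (T := T) side ρ r LeafState.empty pre).2 := by
    intro pre
    induction pre using List.reverseRecOn with
    | nil =>
      intro post _
      exact ⟨fun _ _ => rfl, fun _ _ => by simp [colorEvents, LeafState.empty], rfl,
        by simp [colorEvents], by simp [colorEvents]⟩
    | append_singleton pre x ih =>
      intro post hpost
      have hpost' : E = pre ++ x :: post := by simpa using hpost
      have hI := ih _ hpost'
      rw [colorEvents_append]
      simp only [colorEvents, List.append_nil]
      have hE' : IsEventList side b q h T (pre ++ [x]) := by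
        rw [hpost] at hE
        exact hE.of_append
      cases x with
      | burst v j U =>
        refine hI.burst hE' ?_ (hG.spread _ _ _ _ _ hpost')
        intro u a
        refine le_trans ?_ (hG.load_le u a)
        rw [hpost, load, load, List.countP_append (l₂ := post)]
        exact Nat.le_add_right _ _
      | flush t F => exact hI.flush hE'
  have hI := key E [] (by simp)
  exact ⟨by rw [hI.map_fst], hI.proper⟩

end Coloring

/-! ### The colorer of a bipartite stream -/

section Events

variable {V : Type}

/-- The edge joins the two sides of the bipartition. -/
def crosses (side : V → Bool) (e : Sym2 V) : Bool := decide ¬ (e.map side).IsDiag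

theorem crosses_mk {side : V → Bool} {u v : V} : crosses side s(u, v) = true ↔ side u ≠ side v := by
  simp [crosses]

/-- `u` is a leaf of the event. -/
def Event.HasLeaf (u : V) : Event V → Prop
  | .burst _ _ U => u ∈ U
  | .flush _ _ => False

/-- The center of a star; the default `u` is used for batches. -/
def Event.center (u : V) : Event V → V
  | .burst v _ _ => v
  | .flush _ _ => u

/-- The index of a star; it is `0` for batches. -/
def Event.index : Event V → ℕ
  | .burst _ j _ => j
  | .flush _ _ => 0

theorem eq_of_mem_edges {E : List (Event V)} (hE : (E.flatMap Event.edges).Nodup) {x y : Event V}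
    (hx : x ∈ E) (hy : y ∈ E) {e : Sym2 V} (hex : e ∈ x.edges) (hey : e ∈ y.edges) : x = y := by
  by_contra hne
  rw [List.nodup_flatMap] at hE
  have hs : Std.Symm (Function.onFun List.Disjoint (Event.edges (V := V))) := ⟨fun a b h => h.symm⟩
  exact hE.2.forall hx hy hne hex hey

variable [DecidableEq V]

/-- Every edge has an endpoint. -/
theorem length_le_of_degree [Fintype V] {D : ℕ} (σ : List (Sym2 V))
    (h : ∀ v, (σ.filter (v ∈ ·)).length ≤ D) : σ.length ≤ Fintype.card V * D := by
  have h1 : σ.length ≤ ∑ v : V, (σ.filter (v ∈ ·)).length := by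
    clear h
    induction σ with
    | nil => simp
    | cons e σ ih =>
      have h2 : ∀ v, ((e :: σ).filter (v ∈ ·)).length =
          (σ.filter (v ∈ ·)).length + if v ∈ e then 1 else 0 := by
        intro v
        by_cases hv : v ∈ e <;> simp [hv]
      simp only [h2, Finset.sum_add_distrib, List.length_cons]
      refine Nat.add_le_add ih ?_
      obtain ⟨x, hx⟩ : ∃ x, x ∈ e := by
        induction e with | _ x y => exact ⟨x, Sym2.mem_mk_left _ _⟩
      calc 1 = if x ∈ e then 1 else 0 := by simp [hx]
        _ ≤ _ := Finset.single_le_sum (f := fun v => if v ∈ e then 1 else 0)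
          (fun _ _ => Nat.zero_le _) (Finset.mem_univ x)
  refine h1.trans ((Finset.sum_le_sum fun v _ => h v).trans ?_)
  simp

theorem EdgeBuffer.push_length_le [Fintype V] (b m : ℕ) (B : EdgeBuffer V) (e : Sym2 V) :
    (B.push b m e).2.length ≤ 1 :=
  EdgeBuffer.push_cases b m B e (P := fun r => r.2.length ≤ 1)
    (fun _ _ _ => by simp) (fun _ _ => by simp) (fun _ _ => by simp)

theorem EdgeBuffer.eventsFrom_length_le [Fintype V] (b m : ℕ) (σ : List (Sym2 V))
    (B : EdgeBuffer V) : (EdgeBuffer.eventsFrom b m B σ).length ≤ σ.length + 1 := by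
  induction σ generalizing B with
  | nil => simp [EdgeBuffer.eventsFrom]
  | cons e σ ih =>
    have h1 := EdgeBuffer.push_length_le b m B e
    have h2 := ih (B.push b m e).1
    simp only [EdgeBuffer.eventsFrom, List.length_append, List.length_cons]
    omega

/-- The events of a stream. -/
noncomputable def streamEvents [Fintype V] (b m : ℕ) (σ : List (Sym2 V)) : List (Event V) :=
  EdgeBuffer.eventsFrom b m EdgeBuffer.empty σ

theorem streamEvents_perm [Fintype V] (b m : ℕ) {σ : List (Sym2 V)} (hσ : σ.Nodup) :
    ((streamEvents b m σ).flatMap Event.edges).Perm σ := by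
  simpa [EdgeBuffer.empty, streamEvents] using EdgeBuffer.eventsFrom_perm b m σ EdgeBuffer.empty hσ
    (by simp [EdgeBuffer.empty])

theorem streamEvents_bounded [Fintype V] {b m : ℕ} (hb : 0 < b) {σ : List (Sym2 V)}
    (hσ : σ.Nodup) : ∀ x ∈ streamEvents b m σ, EdgeBuffer.empty.Bounded b m σ x :=
  EdgeBuffer.bounded_of_mem_eventsFrom hb σ EdgeBuffer.empty hσ
    (by simp [EdgeBuffer.empty]) (fun v => by simpa [EdgeBuffer.empty] using hb)

theorem mem_of_mem_leaves [Fintype V] {b m : ℕ} {σ : List (Sym2 V)} (hσ : σ.Nodup) {v u : V}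
    {j : ℕ} {U : Finset V} (hx : Event.burst v j U ∈ streamEvents b m σ) (hu : u ∈ U) :
    s(v, u) ∈ σ := by
  rw [← (streamEvents_perm b m hσ).mem_iff, List.mem_flatMap]
  exact ⟨_, hx, List.mem_map.2 ⟨u, by simpa using hu, rfl⟩⟩

/-- Each star uses up `b` edges at its center and each full batch `card V * q` edges, so the numbers
of stars and batches fit into the palette. -/
theorem isEventList_streamEvents [Fintype V] [Nonempty V] {D b q h T : ℕ} (hb : 0 < b) (hq : 0 < q)
    (hD : D ≤ b * b) (hh : b / q < h) (hT : D / q < T) {side : V → Bool} {σ : List (Sym2 V)}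
    (hσ : IsStream D σ) (hcross : ∀ e ∈ σ, crosses side e = true) :
    IsEventList side b q h T (streamEvents b (Fintype.card V * q) σ) := by
  have hbd := streamEvents_bounded (m := Fintype.card V * q) hb hσ.nodup
  refine ⟨?_, ?_, ?_, ?_, ?_⟩
  · exact EdgeBuffer.eventsFrom_key_nodup hb σ EdgeBuffer.empty hσ.nodup
      (by simp [EdgeBuffer.empty]) (fun v => by simpa [EdgeBuffer.empty] using hb)
  · intro v j U hx
    obtain ⟨-, -, h3⟩ := hbd _ hx
    simp only [EdgeBuffer.empty, Finset.filter_empty, Finset.card_empty, mul_zero, zero_add] at h3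
    have h4 : b * (j + 1) ≤ b * b := h3.trans ((hσ.degree_le v).trans hD)
    have h5 : j + 1 ≤ b := Nat.le_of_mul_le_mul_left h4 hb
    exact lt_of_le_of_lt (Nat.div_le_div_right (by omega)) hh
  · intro v j U hx u hu
    have := hcross _ (mem_of_mem_leaves hσ.nodup hx hu)
    rw [crosses_mk] at this
    exact this.symm
  · intro t F hx
    obtain ⟨-, -, h3⟩ := hbd _ hx
    simp only [EdgeBuffer.empty, Finset.card_empty, mul_zero, zero_add] at h3
    have h4 := h3.trans (length_le_of_degree σ hσ.degree_le)
    rw [mul_assoc] at h4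
    have h5 := Nat.le_of_mul_le_mul_left h4 Fintype.card_pos
    refine lt_of_le_of_lt ?_ hT
    rw [Nat.le_div_iff_mul_le hq, mul_comm]
    exact h5
  · intro t F hx v
    exact ((hbd _ hx).2.1 v).le

/-- The loads are small with high probability, because the centers of the stars with leaf `u` are
distinct and hence shifted independently. -/
theorem unifProb_load_le [Fintype V] {q : ℕ} [NeZero q] {E : List (Event V)} (hnd : E.Nodup)
    (hE : (E.flatMap Event.edges).Nodup) {u : V} {D : ℕ}
    (hD : ((E.flatMap Event.edges).filter (u ∈ ·)).length ≤ D) (a : Fin q) (t : ℕ) :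
    unifProb (fun ρ : V → Fin q => t ≤ load ρ E u a) ≤ (1 + 1 / q) ^ D / 2 ^ t := by
  classical
  set J := E.toFinset.filter fun x => x.HasLeaf u with hJ
  have hedge : ∀ x ∈ J, s(x.center u, u) ∈ x.edges := by
    intro x hx
    have := (Finset.mem_filter.1 hx).2
    cases x with
    | burst v j U => exact List.mem_map.2 ⟨u, by simpa [Event.HasLeaf] using this, rfl⟩
    | flush t F => exact this.elim
  have hinj : Set.InjOn (Event.center u) (J : Set (Event V)) := by
    intro x hx y hy hxy
    have h1 := hedge x hx
    have h2 := hedge y hy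
    rw [← hxy] at h2
    rw [Finset.mem_coe, hJ, Finset.mem_filter, List.mem_toFinset] at hx hy
    exact eq_of_mem_edges hE hx.1 hy.1 h1 h2
  have hcard : J.card ≤ D := by
    refine le_trans ?_ ((List.toFinset_card_le _).trans hD)
    refine Finset.card_le_card_of_injOn (fun x => s(x.center u, u)) ?_ ?_
    · intro x hx
      have h1 := hedge x hx
      rw [Finset.mem_coe, hJ, Finset.mem_filter, List.mem_toFinset] at hx
      rw [Finset.mem_coe, List.mem_toFinset, List.mem_filter]
      exact ⟨List.mem_flatMap.2 ⟨x, hx.1, h1⟩, by simp⟩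
    · intro x hx y hy hxy
      exact hinj hx hy (Sym2.congr_left.1 hxy)
  have htail := unifProb_card_filter_le J (Event.center u) hinj
    (fun x (c : Fin q) => (x.index + c) % q = (a : ℕ)) (p := 1 / q) (by positivity)
    (fun x _ => unifProb_shift_le _ _) t hcard
  refine le_trans (unifProb_mono fun ρ hρ => hρ.trans ?_) htail
  rw [load, List.countP_eq_length_filter, ← List.toFinset_card_of_nodup (hnd.filter _)]
  refine Finset.card_le_card ?_
  intro x hx
  rw [List.mem_toFinset, List.mem_filter, decide_eq_true_eq] at hx
  rw [hJ, Finset.mem_filter, Finset.mem_filter, List.mem_toFinset]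
  cases x with
  | burst v j U =>
    obtain ⟨h1, h2, h3⟩ := hx
    exact ⟨⟨h1, h2⟩, congrArg Fin.val h3⟩
  | flush t F => exact absurd hx.2 Event.not_hits_flush

/-- The leaves of a star spread over the windows with high probability. -/
theorem unifProb_window_le [Fintype V] {q P : ℕ} [NeZero P] (w : ℕ) (U : Finset V) {b : ℕ}
    (hU : U.card ≤ b) (a : Fin q) (k : V → ℕ) (p : Fin P) (t : ℕ) :
    unifProb (fun r : V × Fin q → Fin P =>
      t ≤ (U.filter fun u => leafWindow r w u a (k u) = p).card) ≤ (1 + 1 / P) ^ b / 2 ^ t := by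
  have htail := unifProb_card_filter_le U (fun u => (u, a)) (fun u _ u' _ h => (Prod.ext_iff.1 h).1)
    (fun u (c : Fin P) => (k u / w + c) % P = (p : ℕ)) (p := 1 / P) (by positivity)
    (fun x _ => unifProb_shift_le _ _) t hU
  refine le_trans (unifProb_mono fun r hr => hr.trans_eq ?_) htail
  congr 1
  ext u
  simp [leafWindow, Fin.ext_iff]

/-- A union bound over the loads, and, for fixed `ρ`, over the windows of all stars. The loads before
a star, and hence the current windows up to the random shifts, depend on `ρ` alone. -/
theorem unifProb_not_isGoodSeed_le [Fintype V] {q P : ℕ} [NeZero q] [NeZero P] (w : ℕ)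
    {E : List (Event V)} (hnd : E.Nodup) (hE : (E.flatMap Event.edges).Nodup) {D b : ℕ}
    (hD : ∀ u, ((E.flatMap Event.edges).filter (u ∈ ·)).length ≤ D)
    (hU : ∀ v j U, Event.burst v j U ∈ E → U.card ≤ b) :
    unifProb (fun s : (V → Fin q) × (V × Fin q → Fin P) => ¬ IsGoodSeed w s.1 s.2 E) ≤
      (Fintype.card V * q : ℕ) * ((1 + 1 / q) ^ D / 2 ^ (P * w + 1)) +
      (E.length * P : ℕ) * ((1 + 1 / P) ^ b / 2 ^ (w + 1)) := by
  classical
  set bad : (V → Fin q) → Prop := fun ρ =>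
    ∃ x ∈ (Finset.univ : Finset (V × Fin q)), P * w + 1 ≤ load ρ E x.1 x.2 with hbad
  have hfst : unifProb bad ≤ (Fintype.card V * q : ℕ) * ((1 + 1 / q) ^ D / 2 ^ (P * w + 1)) := by
    have := unifProb_exists_le (Finset.univ : Finset (V × Fin q))
      (fun x (ρ : V → Fin q) => P * w + 1 ≤ load ρ E x.1 x.2)
      (fun x _ => unifProb_load_le hnd hE (hD x.1) x.2 (P * w + 1))
    exact this.trans_eq (by simp)
  refine (unifProb_prod_le_add bad (by positivity) fun ρ hρ => ?_).trans (add_le_add_left hfst _)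
  have hload : ∀ u a, load ρ E u a ≤ P * w := by
    intro u a
    by_contra h
    exact hρ ⟨(u, a), Finset.mem_univ _, by simpa using h⟩
  have hsnd := unifProb_exists_le (Finset.univ : Finset (Fin E.length × Fin P))
    (fun x (r : V × Fin q → Fin P) => ∃ v j U, E[x.1] = Event.burst v j U ∧
      w + 1 ≤ (U.filter fun u => leafWindow r w u (starClass ρ v j)
        (load ρ (E.take x.1) u (starClass ρ v j)) = x.2).card)
    (δ := (1 + 1 / P) ^ b / 2 ^ (w + 1)) ?_
  · refine le_trans (unifProb_mono fun r hr => ?_) (hsnd.trans_eq (by simp))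
    by_contra hcon
    refine hr ⟨hload, ?_⟩
    intro pre v j U post hdec p
    by_contra hlt
    have hlen : pre.length < E.length := by rw [hdec]; simp
    refine hcon ⟨(⟨pre.length, hlen⟩, p), Finset.mem_univ _, v, j, U, ?_, ?_⟩
    · simp [hdec]
    · have : E.take pre.length = pre := by rw [hdec]; simp
      simp only [this]
      exact Nat.lt_of_not_le hlt
  · intro x _
    rcases hx : E[x.1] with ⟨v, j, U⟩ | ⟨t, F⟩
    · refine le_trans (unifProb_mono fun r hr => ?_) (unifProb_window_le w U
        (hU v j U (hx ▸ List.getElem_mem _)) (starClass ρ v j)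
        (fun u => load ρ (E.take x.1) u (starClass ρ v j)) x.2 (w + 1))
      obtain ⟨v', j', U', h1, h2⟩ := hr
      cases h1
      exact h2
    · rw [unifProb_of_forall_not (by simp)]
      positivity

end Events

section Colorer

variable {V : Type} [DecidableEq V] [Fintype V] {b q h P w T : ℕ} [NeZero h] [NeZero w] [NeZero T]

/-- The colorer that buffers up to `m` edges and colors the events of the stream. -/
noncomputable def starColorer (m : ℕ) (side : V → Bool) (ρ : V → Fin q)
    (r : V × Fin q → Fin P) :
    OnlineColorer V (EdgeBuffer V × LeafState V q w) (EventColor b q h P w T) where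
  init := (EdgeBuffer.empty, LeafState.empty)
  step s e := (((s.1.push b m e).1,
      (colorEvents (b := b) (h := h) (T := T) side ρ r s.2 (s.1.push b m e).2).1),
    (colorEvents side ρ r s.2 (s.1.push b m e).2).2)
  finish s := (colorEvents side ρ r s.2 [.flush s.1.flushes s.1.edges]).2

theorem starColorer_output (m : ℕ) (side : V → Bool) (ρ : V → Fin q) (r : V × Fin q → Fin P)
    (σ : List (Sym2 V)) :
    (starColorer (b := b) (h := h) (w := w) (T := T) m side ρ r).output σ =
      (colorEvents side ρ r LeafState.empty (streamEvents b m σ)).2 := by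
  have key : ∀ (σ : List (Sym2 V)) (B : EdgeBuffer V) (st : LeafState V q w),
      (starColorer (b := b) (h := h) (w := w) (T := T) m side ρ r).outputFrom (B, st) σ =
        (colorEvents side ρ r st (EdgeBuffer.eventsFrom b m B σ)).2 := by
    intro σ
    induction σ with
    | nil => intro B st; rfl
    | cons e σ ih =>
      intro B st
      simp only [OnlineColorer.outputFrom, EdgeBuffer.eventsFrom, colorEvents_append]
      rw [← ih]
      rfl
  exact key σ _ _

theorem starColorer_isProperReport_prob [Nonempty V] [NeZero q] [NeZero P] {D : ℕ} (hb : 0 < b)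
    (hD : D ≤ b * b) (hh : b / q < h) (hT : D / q < T) (side : V → Bool) {σ : List (Sym2 V)}
    (hσ : IsStream D σ) (hcross : ∀ e ∈ σ, crosses side e = true) :
    unifProb (fun s : (V → Fin q) × (V × Fin q → Fin P) => ¬ IsProperReport σ
      ((starColorer (b := b) (h := h) (w := w) (T := T) (Fintype.card V * q) side s.1 s.2).output
        σ)) ≤
      (Fintype.card V * q : ℕ) * ((1 + 1 / q) ^ D / 2 ^ (P * w + 1)) +
      ((σ.length + 1) * P : ℕ) * ((1 + 1 / P) ^ b / 2 ^ (w + 1)) := by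
  have hE := isEventList_streamEvents (T := T) hb (NeZero.pos q) hD hh hT hσ hcross
  have hperm := streamEvents_perm b (Fintype.card V * q) hσ.nodup
  have hgood := unifProb_not_isGoodSeed_le (q := q) (P := P) w (hE.key_nodup.of_map _)
    (hperm.nodup_iff.2 hσ.nodup) (D := D) (b := b)
    (fun u => by rw [(hperm.filter _).length_eq]; exact hσ.degree_le u)
    (fun v j U hx => ((streamEvents_bounded hb hσ.nodup) _ hx).2.1)
  have hlen : (streamEvents b (Fintype.card V * q) σ).length ≤ σ.length + 1 :=
    EdgeBuffer.eventsFrom_length_le _ _ _ _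
  have hlen' : (((streamEvents b (Fintype.card V * q) σ).length * P : ℕ) : ℝ) ≤
      ((σ.length + 1) * P : ℕ) := Nat.cast_le.2 (Nat.mul_le_mul_right P hlen)
  have hpos : (0 : ℝ) ≤ (1 + 1 / (P : ℝ)) ^ b / 2 ^ (w + 1) := by positivity
  refine le_trans ?_ (hgood.trans (add_le_add_right (mul_le_mul_of_nonneg_right hlen' hpos) _))
  refine unifProb_mono fun s hs hG => hs ?_
  have hrep := colorEvents_isProperReport (w := w) hE hG
  rw [starColorer_output]
  exact ⟨hrep.1.trans hperm, hrep.2⟩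

end Colorer

/-! ### Memory -/

section Memory

variable {V : Type}

open Classical in
/-- The set of the entries of a table; every set of at most `m` elements is of this form. -/
noncomputable def tableSet {α : Type} [Fintype α] {m : ℕ} (f : Fin m → Option α) : Finset α :=
  Finset.univ.filter fun a => ∃ i, f i = some a

theorem exists_tableSet_eq {α : Type} [Fintype α] {m : ℕ} {F : Finset α} (hF : F.card ≤ m) :
    ∃ f : Fin m → Option α, tableSet f = F := by
  classical
  refine ⟨fun i => F.toList[(i : ℕ)]?, ?_⟩
  ext a
  simp only [tableSet, Finset.mem_filter, Finset.mem_univ, true_and]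
  rw [← Finset.mem_toList, List.mem_iff_getElem?]
  constructor
  · rintro ⟨i, hi⟩
    exact ⟨i, hi⟩
  · rintro ⟨i, hi⟩
    have hlt : i < F.toList.length := (List.getElem?_eq_some_iff.1 hi).1
    rw [Finset.length_toList] at hlt
    exact ⟨⟨i, hlt.trans_le hF⟩, hi⟩

/-- The states of the colorer in a finite form: the buffer as a table with `m` entries, and all
counters below `N`. -/
abbrev StateCode (V : Type) (q w m N : ℕ) : Type :=
  (Fin m → Option (Sym2 V)) × Fin N × (V → Fin N) × (V → Fin q → Fin N) ×
    (V → Fin q → Finset (Fin (2 * w)))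

/-- At most `m` edges are buffered, and all counters are at most `N`. -/
structure IsSmallState {q w : ℕ} (m N : ℕ) (s : EdgeBuffer V × LeafState V q w) : Prop where
  card_edges_le : s.1.edges.card ≤ m
  flushes_le : s.1.flushes ≤ N
  bursts_le : ∀ v, s.1.bursts v ≤ N
  count_le : ∀ u a, s.2.count u a ≤ N

theorem IsSmallState.mono {m N N' : ℕ} {s : EdgeBuffer V × LeafState V q w}
    (hs : IsSmallState m N s) (hN : N ≤ N') : IsSmallState m N' s :=
  ⟨hs.card_edges_le, hs.flushes_le.trans hN, fun v => (hs.bursts_le v).trans hN,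
    fun u a => (hs.count_le u a).trans hN⟩

variable [Fintype V]

/-- Reads a state from its code. -/
noncomputable def StateCode.decode {q w m N : ℕ} (c : StateCode V q w m N) :
    EdgeBuffer V × LeafState V q w :=
  (⟨tableSet c.1, c.2.1, fun v => c.2.2.1 v⟩, ⟨fun u a => c.2.2.2.1 u a, c.2.2.2.2⟩)

theorem IsSmallState.exists_decode {q w m N : ℕ} {s : EdgeBuffer V × LeafState V q w}
    (hs : IsSmallState m N s) : ∃ c : StateCode V q w m (N + 1), c.decode = s := by
  obtain ⟨f, hf⟩ := exists_tableSet_eq hs.card_edges_le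
  refine ⟨(f, ⟨s.1.flushes, Nat.lt_succ_of_le hs.flushes_le⟩,
    fun v => ⟨s.1.bursts v, Nat.lt_succ_of_le (hs.bursts_le v)⟩,
    fun u a => ⟨s.2.count u a, Nat.lt_succ_of_le (hs.count_le u a)⟩, s.2.used), ?_⟩
  rw [StateCode.decode, hf]

variable [DecidableEq V] {b q h P w T : ℕ} [NeZero h] [NeZero w] [NeZero T]

theorem IsSmallState.step {m N : ℕ} (side : V → Bool) (ρ : V → Fin q)
    (r : V × Fin q → Fin P) {s : EdgeBuffer V × LeafState V q w} (hs : IsSmallState m N s)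
    (e : Sym2 V) : IsSmallState m (N + 1)
      ((starColorer (b := b) (h := h) (T := T) m side ρ r).step s e).1 := by
  have hins := Finset.card_insert_le e s.1.edges
  simp only [starColorer]
  refine EdgeBuffer.push_cases b m s.1 e (P := fun x => IsSmallState m (N + 1)
    (x.1, (colorEvents (b := b) (h := h) (T := T) side ρ r s.2 x.2).1)) ?_ ?_ ?_
  · intro v hv _
    refine ⟨?_, Nat.le_succ_of_le hs.flushes_le, ?_, ?_⟩
    · refine (Finset.card_le_card ?_).trans hs.card_edges_le
      intro f hf
      simp only [Finset.mem_filter, Finset.mem_insert] at hf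
      rcases hf.1 with rfl | h1
      · exact absurd hv hf.2
      · exact h1
    · intro x
      by_cases hx : x = v
      · subst hx
        simpa using hs.bursts_le x
      · simpa [hx] using Nat.le_succ_of_le (hs.bursts_le x)
    · intro u a
      exact (colorEvent_count_le _ _ _ _ _ _ _).trans (Nat.succ_le_succ (hs.count_le u a))
  · intro _ _
    refine ⟨by simp, Nat.succ_le_succ hs.flushes_le,
      fun v => Nat.le_succ_of_le (hs.bursts_le v), ?_⟩
    intro u a
    exact (colorEvent_count_le _ _ _ _ _ _ _).trans (Nat.succ_le_succ (hs.count_le u a))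
  · intro _ hlt
    exact ⟨hlt.le, Nat.le_succ_of_le hs.flushes_le, fun v => Nat.le_succ_of_le (hs.bursts_le v),
      fun u a => Nat.le_succ_of_le (hs.count_le u a)⟩

/-- No counter exceeds the number of edges that have arrived. -/
theorem isSmallState_stateAfter {m : ℕ} (side : V → Bool) (ρ : V → Fin q)
    (r : V × Fin q → Fin P) (σ : List (Sym2 V)) :
    IsSmallState m σ.length ((starColorer (b := b) (h := h) (w := w) (T := T) m side ρ r).stateAfter
      (starColorer (b := b) (h := h) (w := w) (T := T) m side ρ r).init σ) := by
  induction σ using List.reverseRecOn with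
  | nil => exact ⟨by simp [OnlineColorer.stateAfter, starColorer, EdgeBuffer.empty], le_rfl,
      fun _ => le_rfl, fun _ _ => le_rfl⟩
  | append_singleton σ e ih =>
    rw [OnlineColorer.stateAfter, List.foldl_append, List.length_append]
    exact ih.step side ρ r e

/-- The colorer with its states in finite form. -/
noncomputable def codedStarColorer (m : ℕ) (side : V → Bool) (ρ : V → Fin q)
    (r : V × Fin q → Fin P) :
    OnlineColorer V (StateCode V q w m (Fintype.card (Sym2 V) + 1)) (EventColor b q h P w T) :=
  (starColorer (b := b) (h := h) (w := w) (T := T) m side ρ r).encode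
    (Function.invFun StateCode.decode) StateCode.decode

theorem codedStarColorer_output {m : ℕ} (side : V → Bool) (ρ : V → Fin q)
    (r : V × Fin q → Fin P) {σ : List (Sym2 V)} (hσ : σ.Nodup) :
    (codedStarColorer (b := b) (h := h) (w := w) (T := T) m side ρ r).output σ =
      (starColorer (b := b) (h := h) (w := w) (T := T) m side ρ r).output σ := by
  refine OnlineColorer.encode_output _ _ _ _ fun p hp => Function.invFun_eq ?_
  refine ((isSmallState_stateAfter side ρ r p).mono ?_).exists_decode
  exact (hσ.sublist hp.sublist).length_le_card

theorem card_stateCode (q w m N : ℕ) : Fintype.card (StateCode V q w m N) =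
    (Fintype.card (Sym2 V) + 1) ^ m * (N * (N ^ Fintype.card V *
      ((N ^ q) ^ Fintype.card V * (((2 ^ (2 * w)) ^ q) ^ Fintype.card V)))) := by
  simp

/-- The colorer that stores all edges and colors them greedily at the end. -/
noncomputable def storeColorer (V : Type) [Fintype V] [DecidableEq V] (D : ℕ) :
    OnlineColorer V (Finset (Sym2 V)) (Fin (2 * D + 1)) where
  init := ∅
  step F e := (insert e F, [])
  finish F := F.toList.map fun e => (e, batchColor D F e)

theorem storeColorer_stateAfter (D : ℕ) (σ : List (Sym2 V)) :
    (storeColorer V D).stateAfter (storeColorer V D).init σ = σ.toFinset := by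
  induction σ using List.reverseRecOn with
  | nil => rfl
  | append_singleton σ e ih =>
    simp only [OnlineColorer.stateAfter, List.foldl_append] at ih ⊢
    rw [ih]
    ext f
    simp [storeColorer]

theorem storeColorer_output (D : ℕ) (σ : List (Sym2 V)) :
    (storeColorer V D).output σ = σ.toFinset.toList.map fun e => (e, batchColor D σ.toFinset e) := by
  have key : ∀ (σ : List (Sym2 V)) (F : Finset (Sym2 V)), (storeColorer V D).outputFrom F σ =
      (storeColorer V D).finish ((storeColorer V D).stateAfter F σ) := by
    intro σ
    induction σ with
    | nil => intro F; rfl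
    | cons e σ ih => intro F; exact ih _
  rw [OnlineColorer.output, key, storeColorer_stateAfter]
  rfl

theorem storeColorer_isProperReport {D : ℕ} {σ : List (Sym2 V)} (hσ : IsStream D σ) :
    IsProperReport σ ((storeColorer V D).output σ) := by
  have hF : ∀ v, (σ.toFinset.filter (v ∈ ·)).card ≤ D := by
    intro v
    refine le_trans ?_ (hσ.degree_le v)
    have := List.toFinset_card_le (σ.filter (v ∈ ·))
    rw [List.toFinset_filter] at this
    simpa using this
  rw [storeColorer_output]
  refine ⟨?_, ?_⟩
  · simp only [List.map_map, Function.comp_def, List.map_id']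
    exact List.toFinset_toList hσ.nodup
  · intro x hx y hy hc hz
    obtain ⟨e, he, rfl⟩ := List.mem_map.1 hx
    obtain ⟨e', he', rfl⟩ := List.mem_map.1 hy
    rw [Finset.mem_toList] at he he'
    exact batchColor_isProperOn hF e he e' he' hc hz

end Memory

/-! ### Parameters -/

theorem one_add_inv_pow_div_le {q m k t g : ℕ} (hq : 0 < q) (h : m ≤ q * k) (ht : 2 * k + g ≤ t) :
    (1 + 1 / (q : ℝ)) ^ m / 2 ^ t ≤ 1 / 2 ^ g := by
  have hq' : (0 : ℝ) < q := by exact_mod_cast hq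
  have h1 : (1 + 1 / (q : ℝ)) ^ m ≤ 2 ^ (2 * k) := by
    have h2 : 1 + 1 / (q : ℝ) ≤ Real.exp (1 / q) := by
      rw [add_comm]; exact Real.add_one_le_exp _
    calc (1 + 1 / (q : ℝ)) ^ m ≤ Real.exp (1 / q) ^ m := by gcongr
      _ = Real.exp (m * (1 / q)) := (Real.exp_nat_mul _ _).symm
      _ ≤ Real.exp (k * 1) := by
        apply Real.exp_le_exp.2
        rw [mul_one_div, div_le_iff₀ hq', mul_one]
        exact_mod_cast (mul_comm q k ▸ h)
      _ = Real.exp 1 ^ k := Real.exp_nat_mul _ _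
      _ ≤ 4 ^ k := by
        gcongr
        exact (Real.exp_one_lt_d9.trans (by norm_num)).le
      _ = 2 ^ (2 * k) := by rw [pow_mul]; norm_num
  rw [div_le_div_iff₀ (by positivity) (by positivity), one_mul]
  calc (1 + 1 / (q : ℝ)) ^ m * 2 ^ g ≤ 2 ^ (2 * k) * 2 ^ g := by gcongr
    _ = 2 ^ (2 * k + g) := (pow_add _ _ _).symm
    _ ≤ 2 ^ t := pow_le_pow_right₀ (by norm_num) ht

theorem card_sym2_add_one_le {V : Type} [Fintype V] {lam : ℕ} (hlam : Fintype.card V < 2 ^ lam) :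
    Fintype.card (Sym2 V) + 1 ≤ 2 ^ (2 * lam) := by
  rw [Sym2.card, Nat.choose_two_right, Nat.add_sub_cancel]
  have h1 := Nat.div_le_self ((Fintype.card V + 1) * Fintype.card V) 2
  have h2 : (Fintype.card V + 1) * (Fintype.card V + 1) ≤ 2 ^ lam * 2 ^ lam :=
    Nat.mul_le_mul hlam hlam
  rw [two_mul, pow_add]
  nlinarith

/-- A colorer for streams that cross a given bipartition, with the parameters in terms of the
number `q` of classes; `lam` and `gam` are a bound on the logarithm of the number of vertices and
the exponent of the failure probability. -/
theorem exists_crossing_colorer {V : Type} [Fintype V] [DecidableEq V] [Nonempty V]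
    {lam gam D q : ℕ} (hlam : Fintype.card V < 2 ^ lam) (hgam : 1 ≤ gam)
    (hD : D ≤ Fintype.card V) (hq : 1 ≤ q) (hqb : q ≤ Nat.sqrt D + 1)
    (hgb : gam ≤ Nat.sqrt D + 1) :
    ∃ (Ω S κ : Type) (_ : Fintype Ω) (_ : Nonempty Ω) (_ : Fintype S) (_ : Fintype κ)
      (A : (V → Bool) → Ω → OnlineColorer V S κ),
      Fintype.card Ω * Fintype.card S ≤ 2 ^ (Fintype.card V * q * (14 * lam + 8 * gam)) ∧
      Fintype.card κ ≤ (Nat.sqrt D + 1) * (35 * (D / q) + 35 + 64 * (Nat.sqrt D + 1)) ∧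
      ∀ (side : V → Bool) (σ : List (Sym2 V)), IsStream D σ → (∀ e ∈ σ, crosses side e = true) →
        unifProb (fun ω => ¬ IsProperReport σ ((A side ω).output σ)) ≤ 2 ^ (8 * lam) / 2 ^ gam := by
  set n := Fintype.card V with hn
  have hn0 : 0 < n := Fintype.card_pos
  set b := Nat.sqrt D + 1 with hb
  have hb0 : 0 < b := Nat.succ_pos _
  have hDb : D ≤ b * b := (Nat.lt_succ_sqrt D).le
  have hbD : b ≤ D + 1 := Nat.succ_le_succ (Nat.sqrt_le_self D)
  have hlam0 : 1 ≤ lam := by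
    rcases Nat.eq_zero_or_pos lam with h | h
    · rw [h] at hlam; omega
    · exact h
  -- `P * w` exceeds both `4 * D / q` and `4 * b`
  set w := 4 * gam with hw
  set P := (4 * (D / q) + 4 + 4 * b) / w + 1 with hP
  have hw0 : 0 < w := by omega
  have hP0 : 0 < P := Nat.succ_pos _
  have hPw : 4 * (D / q) + 4 + 4 * b ≤ P * w := by
    have := Nat.lt_div_mul_add (a := 4 * (D / q) + 4 + 4 * b) hw0
    rw [hP, Nat.add_mul, one_mul]
    omega
  have hPw' : P * w ≤ 4 * (D / q) + 4 + 4 * b + w := by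
    have := Nat.div_mul_le_self (4 * (D / q) + 4 + 4 * b) w
    rw [hP, Nat.add_mul, one_mul]
    omega
  set Y := 2 ^ lam with hY
  have hYn : n + 1 ≤ Y := hlam
  have hY2 : 2 ≤ Y := by
    calc 2 = 2 ^ 1 := rfl
      _ ≤ Y := Nat.pow_le_pow_right (by norm_num) hlam0
  have hqY : q ≤ Y := by omega
  have hDq : D / q ≤ D := Nat.div_le_self _ _
  have hPY : P ≤ Y ^ 5 := by
    have h1 : P ≤ 4 * (D / q) + 4 + 4 * b + 1 := Nat.succ_le_succ (Nat.div_le_self _ _)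
    have h2 : 16 * Y ≤ Y ^ 5 := by
      calc 16 * Y = 2 ^ 4 * Y := by norm_num
        _ ≤ Y ^ 4 * Y := Nat.mul_le_mul_right _ (Nat.pow_le_pow_left hY2 4)
        _ = Y ^ 5 := by ring
    omega
  set N := Fintype.card (Sym2 V) + 1 with hN
  have hNY : N ≤ Y ^ 2 := by
    rw [hN, hY, ← pow_mul, mul_comm lam]
    exact card_sym2_add_one_le hlam
  have : NeZero q := ⟨by omega⟩
  have : NeZero w := ⟨by omega⟩
  have : NeZero P := ⟨hP0.ne'⟩
  set X := n * q with hX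
  have hX1 : 1 ≤ X := Nat.mul_pos hn0 hq
  have hnX : n ≤ X := Nat.le_mul_of_pos_right n hq
  refine ⟨(V → Fin q) × (V × Fin q → Fin P), StateCode V q w X N,
    EventColor b q (b / q + 1) P w (D / q + 1), inferInstance, ?_, inferInstance, inferInstance,
    fun side s => codedStarColorer X side s.1 s.2, ?_, ?_, ?_⟩
  · exact ⟨(fun _ => ⟨0, by omega⟩, fun _ => ⟨0, hP0⟩)⟩
  · have hpow : ∀ {x k e : ℕ}, x ≤ Y ^ k → e ≤ X → x ^ e ≤ 2 ^ (lam * k * X) := by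
      intro x k e hx he
      calc x ^ e ≤ (Y ^ k) ^ e := Nat.pow_le_pow_left hx e
        _ = 2 ^ (lam * k * e) := by rw [hY, ← pow_mul, ← pow_mul, mul_assoc]
        _ ≤ 2 ^ (lam * k * X) := Nat.pow_le_pow_right (by norm_num) (Nat.mul_le_mul_left _ he)
    have e1 : q ^ n ≤ 2 ^ (lam * 1 * X) := hpow (by simpa using hqY) hnX
    have e2 : P ^ X ≤ 2 ^ (lam * 5 * X) := hpow hPY le_rfl
    have e3 : N ^ X ≤ 2 ^ (lam * 2 * X) := hpow hNY le_rfl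
    have e4 : N ≤ 2 ^ (lam * 2 * X) := by simpa using hpow hNY hX1
    have e5 : N ^ n ≤ 2 ^ (lam * 2 * X) := hpow hNY hnX
    have e6 : (N ^ q) ^ n ≤ 2 ^ (lam * 2 * X) := by
      rw [← pow_mul, mul_comm]; exact hpow hNY le_rfl
    have e7 : ((2 ^ (2 * w)) ^ q) ^ n ≤ 2 ^ (8 * gam * X) := by
      rw [← pow_mul, ← pow_mul]
      refine Nat.pow_le_pow_right (by norm_num) (le_of_eq ?_)
      rw [hw, hX]; ring
    rw [card_stateCode, Fintype.card_prod, Fintype.card_fun, Fintype.card_fun, Fintype.card_prod,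
      Fintype.card_fin, Fintype.card_fin, ← hn, ← hN]
    calc q ^ n * P ^ (n * q) * (N ^ X * (N * (N ^ n * ((N ^ q) ^ n * ((2 ^ (2 * w)) ^ q) ^ n))))
        ≤ 2 ^ (lam * 1 * X) * 2 ^ (lam * 5 * X) * (2 ^ (lam * 2 * X) * (2 ^ (lam * 2 * X) *
          (2 ^ (lam * 2 * X) * (2 ^ (lam * 2 * X) * 2 ^ (8 * gam * X))))) := by gcongr
      _ = 2 ^ (X * (14 * lam + 8 * gam)) := by
        rw [← pow_add, ← pow_add, ← pow_add, ← pow_add, ← pow_add, ← pow_add]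
        congr 1; ring
  · simp only [Fintype.card_sum, Fintype.card_prod, Fintype.card_fin, Fintype.card_bool]
    have h1 : q * (b / q + 1) ≤ 2 * b := by
      have := Nat.mul_div_le b q
      rw [mul_add, mul_one]
      omega
    have h2 : (D / q + 1) * (2 * b + 1) ≤ (D / q + 1) * (3 * b) := Nat.mul_le_mul_left _ (by omega)
    have h3 : P * w ≤ 4 * (D / q) + 4 + 8 * b := by omega
    calc (D / q + 1) * (2 * b + 1) + 2 * (q * ((b / q + 1) * (P * (2 * w))))
        = (D / q + 1) * (2 * b + 1) + 4 * ((q * (b / q + 1)) * (P * w)) := by ring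
      _ ≤ (D / q + 1) * (3 * b) + 4 * ((2 * b) * (4 * (D / q) + 4 + 8 * b)) := by gcongr
      _ = b * (35 * (D / q) + 35 + 64 * b) := by ring
  · intro side σ hσ hcross
    have hout : ∀ s : (V → Fin q) × (V × Fin q → Fin P),
        (codedStarColorer (b := b) (h := b / q + 1) (w := w) (T := D / q + 1) X side s.1 s.2).output
          σ = (starColorer (b := b) (h := b / q + 1) (w := w) (T := D / q + 1) X side s.1
            s.2).output σ := fun s => codedStarColorer_output side s.1 s.2 hσ.nodup
    simp only [hout]
    refine (starColorer_isProperReport_prob (h := b / q + 1) (w := w) (T := D / q + 1) (q := q)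
      (P := P) hb0 hDb (Nat.lt_succ_self _) (Nat.lt_succ_self _) side hσ hcross).trans ?_
    have p1 : (1 + 1 / (q : ℝ)) ^ D / 2 ^ (P * w + 1) ≤ 1 / 2 ^ gam := by
      refine one_add_inv_pow_div_le (k := D / q + 1) hq (Nat.lt_mul_div_succ D hq).le ?_
      omega
    have p2 : (1 + 1 / (P : ℝ)) ^ b / 2 ^ (w + 1) ≤ 1 / 2 ^ gam := by
      refine one_add_inv_pow_div_le (k := gam) hP0 ?_ (by omega)
      have : 4 * b ≤ 4 * (P * gam) := by
        calc 4 * b ≤ P * w := by omega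
          _ = 4 * (P * gam) := by rw [hw]; ring
      omega
    have hlen : σ.length + 1 ≤ Y ^ 2 := by
      calc σ.length + 1 ≤ n * D + 1 := Nat.succ_le_succ (length_le_of_degree σ hσ.degree_le)
        _ ≤ n * n + 1 := by gcongr
        _ ≤ (n + 1) * (n + 1) := by nlinarith
        _ ≤ Y * Y := Nat.mul_le_mul hYn hYn
        _ = Y ^ 2 := by ring
    have hcount : n * q + (σ.length + 1) * P ≤ 2 ^ (8 * lam) := by
      calc n * q + (σ.length + 1) * P ≤ Y * Y + Y ^ 2 * Y ^ 5 := by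
            gcongr
        _ = Y ^ 2 * 1 + Y ^ 7 := by ring
        _ ≤ Y ^ 2 * Y ^ 5 + Y ^ 7 := by
          gcongr
          exact Nat.one_le_pow _ _ (by omega)
        _ = 2 * Y ^ 7 := by ring
        _ ≤ Y * Y ^ 7 := Nat.mul_le_mul_right _ hY2
        _ = 2 ^ (8 * lam) := by rw [hY, ← pow_mul, ← pow_add]; congr 1; ring
    calc ((n * q : ℕ) : ℝ) * ((1 + 1 / (q : ℝ)) ^ D / 2 ^ (P * w + 1)) +
          (((σ.length + 1) * P : ℕ) : ℝ) * ((1 + 1 / (P : ℝ)) ^ b / 2 ^ (w + 1))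
        ≤ ((n * q : ℕ) : ℝ) * (1 / 2 ^ gam) + (((σ.length + 1) * P : ℕ) : ℝ) * (1 / 2 ^ gam) := by
          gcongr
      _ = ((n * q + (σ.length + 1) * P : ℕ) : ℝ) / 2 ^ gam := by push_cast; ring
      _ ≤ ((2 ^ (8 * lam) : ℕ) : ℝ) / 2 ^ gam := by gcongr
      _ = 2 ^ (8 * lam) / 2 ^ gam := by push_cast; rfl

/-! ### Random bipartitions and the recursion on the degree -/

section Recursion

theorem three_halves_pow_div_le {D g : ℕ} (h : 8 * g ≤ D) :
    (1 + 1 / 2 : ℝ) ^ D / 2 ^ (3 * D / 4 + 1) ≤ 1 / 2 ^ g := by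
  rw [div_le_div_iff₀ (by positivity) (by positivity), one_mul]
  -- `(3 / 2) ^ 8 ≤ 2 ^ 5`
  refine (pow_le_pow_iff_left₀ (by positivity) (by positivity) (n := 8) (by norm_num)).1 ?_
  calc ((1 + 1 / 2 : ℝ) ^ D * 2 ^ g) ^ 8 = ((1 + 1 / 2 : ℝ) ^ 8) ^ D * 2 ^ (8 * g) := by
        rw [mul_pow, ← pow_mul, ← pow_mul, ← pow_mul, mul_comm D 8, mul_comm g 8]
    _ ≤ (2 ^ 5) ^ D * 2 ^ (8 * g) := by gcongr; norm_num
    _ = 2 ^ (5 * D + 8 * g) := by rw [← pow_mul, ← pow_add]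
    _ ≤ 2 ^ ((3 * D / 4 + 1) * 8) := pow_le_pow_right₀ (by norm_num) (by omega)
    _ = (2 ^ (3 * D / 4 + 1)) ^ 8 := pow_mul _ _ _

theorem unifProb_bool (c : Bool) : unifProb (fun x : Bool => x = c) ≤ 1 / 2 := by
  have h : (Finset.univ.filter fun x : Bool => x = c).card = 1 := by cases c <;> decide
  rw [unifProb_eq, h]
  simp

variable {V : Type}

/-- There is a randomized streaming algorithm with `bits` bits of memory, seed included, that uses
at most `K` colors and fails with probability at most `δ` on each stream of maximum degree at most
`D`. -/
def HasColorer (V : Type) [DecidableEq V] (D bits : ℕ) (K δ : ℝ) : Prop :=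
  ∃ (Ω S κ : Type) (_ : Fintype Ω) (_ : Nonempty Ω) (_ : Fintype S) (_ : Fintype κ)
    (A : Ω → OnlineColorer V S κ),
    Fintype.card Ω * Fintype.card S ≤ 2 ^ bits ∧ (Fintype.card κ : ℝ) ≤ K ∧
      ∀ σ, IsStream D σ → unifProb (fun ω => ¬ IsProperReport σ ((A ω).output σ)) ≤ δ

variable [DecidableEq V]

theorem HasColorer.mono {D bits bits' : ℕ} {K K' δ δ' : ℝ} (h : HasColorer V D bits K δ)
    (hb : bits ≤ bits') (hK : K ≤ K') (hδ : δ ≤ δ') : HasColorer V D bits' K' δ' := by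
  obtain ⟨Ω, S, κ, i1, i2, i3, i4, A, h1, h2, h3⟩ := h
  exact ⟨Ω, S, κ, i1, i2, i3, i4, A, h1.trans (Nat.pow_le_pow_right (by norm_num) hb), h2.trans hK,
    fun σ hσ => (h3 σ hσ).trans hδ⟩

variable [Fintype V]

/-- In a random bipartition, the edges inside the two sides form a graph whose maximum degree is
smaller by a constant factor. -/
theorem unifProb_not_isStream_le {D g : ℕ} (h : 8 * g ≤ D) {σ : List (Sym2 V)}
    (hσ : IsStream D σ) :
    unifProb (fun side : V → Bool =>
      ¬ IsStream (3 * D / 4) (σ.filter fun e => !crosses side e)) ≤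
      (2 * Fintype.card V : ℕ) * (1 / 2 ^ g) := by
  have hcard : ∀ x : V, (Finset.univ.filter fun y => s(x, y) ∈ σ).card ≤ D := by
    intro x
    refine le_trans ?_ ((List.toFinset_card_le _).trans (hσ.degree_le x))
    refine Finset.card_le_card_of_injOn (fun y => s(x, y)) ?_ ?_
    · intro y hy
      simpa using hy
    · intro y _ y' _ hyy
      exact Sym2.congr_right.1 hyy
  have hdeg : ∀ (side : V → Bool) (x : V),
      ((σ.filter fun e => !crosses side e).filter (x ∈ ·)).length ≤
        ((Finset.univ.filter fun y => s(x, y) ∈ σ).filter fun y => side y = side x).card := by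
    intro side x
    rw [← List.toFinset_card_of_nodup ((hσ.nodup.filter _).filter _)]
    refine le_trans (Finset.card_le_card ?_) (Finset.card_image_le (f := fun y => s(x, y)))
    intro e he
    rw [List.mem_toFinset, List.mem_filter, List.mem_filter, decide_eq_true_eq] at he
    obtain ⟨⟨h1, h2⟩, y, rfl⟩ := he
    refine Finset.mem_image.2 ⟨y, ?_, rfl⟩
    have h3 : side x = side y := by
      by_contra hne
      rw [crosses_mk.2 hne] at h2
      simp at h2
    simp [h1, h3]
  have hunion := unifProb_exists_le (Finset.univ : Finset (V × Bool))
    (fun x (side : V → Bool) => 3 * D / 4 + 1 ≤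
      ((Finset.univ.filter fun y => s(x.1, y) ∈ σ).filter fun y => side y = x.2).card)
    (δ := 1 / 2 ^ g) (fun x _ => (unifProb_card_filter_le _ (fun y => y)
      (fun _ _ _ _ hyy => hyy) (fun _ (c : Bool) => c = x.2) (by norm_num)
      (fun _ _ => unifProb_bool _) _ (hcard x.1)).trans (three_halves_pow_div_le h))
  refine (unifProb_mono fun side hside => ?_).trans (hunion.trans_eq ?_)
  · by_contra hcon
    refine hside ⟨hσ.nodup.filter _, (hσ.filter _).not_isDiag, fun x => (hdeg side x).trans ?_⟩
    by_contra hlt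
    exact hcon ⟨(x, side x), Finset.mem_univ _, by simpa using Nat.lt_of_not_le hlt⟩
  · rw [Finset.card_univ, Fintype.card_prod, Fintype.card_bool, mul_comm 2]

/-- Storing the whole graph takes `2 * lam` bits for each edge. -/
theorem hasColorer_store {lam : ℕ} (hlam : Fintype.card V < 2 ^ lam) (D : ℕ) :
    HasColorer V D (2 * lam * (Fintype.card V * D)) (2 * D + 1) 0 := by
  refine ⟨Unit, Fin (Fintype.card V * D) → Option (Sym2 V), Fin (2 * D + 1), inferInstance,
    inferInstance, inferInstance, inferInstance,
    fun _ => (storeColorer V D).encode (Function.invFun tableSet) tableSet, ?_, by simp, ?_⟩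
  · simp only [Fintype.card_unit, one_mul, Fintype.card_fun, Fintype.card_option, Fintype.card_fin]
    rw [pow_mul 2 (2 * lam)]
    exact Nat.pow_le_pow_left (card_sym2_add_one_le hlam) _
  · intro σ hσ
    rw [unifProb_of_forall_not]
    intro _
    rw [not_not, OnlineColorer.encode_output]
    · exact storeColorer_isProperReport hσ
    · intro p hp
      refine Function.invFun_eq (exists_tableSet_eq ?_)
      rw [storeColorer_stateAfter]
      exact (List.toFinset_card_le p).trans (hp.length_le.trans
        (length_le_of_degree σ hσ.degree_le))

/-- One level of the recursion: a random bipartition, a colorer for the edges that cross it, and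
the given colorer for the other edges. -/
theorem HasColorer.step [Nonempty V] {lam gam D q bits : ℕ} {K δ : ℝ}
    (hlam : Fintype.card V < 2 ^ lam) (hgam : 1 ≤ gam) (hD : D ≤ Fintype.card V) (hq : 1 ≤ q)
    (hqb : q ≤ Nat.sqrt D + 1) (hgb : gam ≤ Nat.sqrt D + 1) (hgD : 8 * gam ≤ D)
    (hrec : HasColorer V (3 * D / 4) bits K δ) :
    HasColorer V D (Fintype.card V + Fintype.card V * q * (14 * lam + 8 * gam) + bits)
      (((Nat.sqrt D + 1) * (35 * (D / q) + 35 + 64 * (Nat.sqrt D + 1)) : ℕ) + K)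
      (2 ^ (10 * lam) / 2 ^ gam + δ) := by
  obtain ⟨Ω₁, S₁, κ₁, i1, i2, i3, i4, A₁, hA₁, hK₁, hp₁⟩ :=
    exists_crossing_colorer hlam hgam hD hq hqb hgb
  obtain ⟨Ω₂, S₂, κ₂, j1, j2, j3, j4, A₂, hA₂, hK₂, hp₂⟩ := hrec
  refine ⟨(V → Bool) × (Ω₁ × Ω₂), S₁ × S₂, κ₁ ⊕ κ₂, inferInstance, inferInstance, inferInstance,
    inferInstance, fun s => (A₁ s.1 s.2.1).split (crosses s.1) (A₂ s.2.2), ?_, ?_, ?_⟩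
  · simp only [Fintype.card_prod, Fintype.card_fun, Fintype.card_bool]
    calc 2 ^ Fintype.card V * (Fintype.card Ω₁ * Fintype.card Ω₂) *
          (Fintype.card S₁ * Fintype.card S₂) = 2 ^ Fintype.card V *
          (Fintype.card Ω₁ * Fintype.card S₁) * (Fintype.card Ω₂ * Fintype.card S₂) := by ring
      _ ≤ 2 ^ Fintype.card V * 2 ^ (Fintype.card V * q * (14 * lam + 8 * gam)) * 2 ^ bits := by
        gcongr
      _ = _ := by rw [← pow_add, ← pow_add]
  · rw [Fintype.card_sum, Nat.cast_add]
    exact add_le_add (Nat.cast_le.2 hK₁) hK₂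
  · intro σ hσ
    have hempty : 0 ≤ δ := (unifProb_nonneg _).trans (hp₂ [] ⟨List.nodup_nil, by simp, by simp⟩)
    have hpos : (0 : ℝ) ≤ 2 ^ (8 * lam) / 2 ^ gam + δ := by positivity
    refine le_trans (unifProb_prod_le_add (fun side : V → Bool =>
      ¬ IsStream (3 * D / 4) (σ.filter fun e => !crosses side e)) hpos ?_) ?_
    · intro side hside
      rw [not_not] at hside
      have h1 := hp₁ side (σ.filter (crosses side)) (hσ.filter _)
        (fun e he => List.of_mem_filter he)
      have h2 := hp₂ _ hside
      have h3 := (unifProb_fst_le (Ω' := Ω₂) _).trans h1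
      have h4 := (unifProb_snd_le (Ω := Ω₁) _).trans h2
      refine le_trans (unifProb_mono fun ω hω => ?_)
        ((unifProb_or_le _ _).trans (add_le_add h3 h4))
      by_contra hcon
      rw [not_or, not_not, not_not] at hcon
      exact hω (OnlineColorer.split_isProperReport hcon.1 hcon.2)
    · have h1 := unifProb_not_isStream_le hgD hσ
      have h2 : (2 * Fintype.card V : ℕ) + 2 ^ (8 * lam) ≤ 2 ^ (10 * lam) := by
        have hlam0 : 1 ≤ lam := by
          rcases Nat.eq_zero_or_pos lam with h | h
          · have := Fintype.card_pos (α := V)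
            rw [h] at hlam; omega
          · exact h
        have h3 : 2 ^ lam ≤ 2 ^ (8 * lam) := Nat.pow_le_pow_right (by norm_num) (by omega)
        have h4 : 4 * 2 ^ (8 * lam) ≤ 2 ^ (10 * lam) := by
          calc 4 * 2 ^ (8 * lam) = 2 ^ (2 + 8 * lam) := by rw [pow_add]; norm_num
            _ ≤ 2 ^ (10 * lam) := Nat.pow_le_pow_right (by norm_num) (by omega)
        omega
      have h3 : ((2 * Fintype.card V : ℕ) : ℝ) + 2 ^ (8 * lam) ≤ 2 ^ (10 * lam) := by
        exact_mod_cast h2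
      calc _ ≤ ((2 * Fintype.card V : ℕ) : ℝ) * (1 / 2 ^ gam) + (2 ^ (8 * lam) / 2 ^ gam + δ) := by
            gcongr
        _ = (((2 * Fintype.card V : ℕ) : ℝ) + 2 ^ (8 * lam)) / 2 ^ gam + δ := by ring
        _ ≤ 2 ^ (10 * lam) / 2 ^ gam + δ := by gcongr

/-- The number of colors of one level is `O(b * D / q)` with `b ≈ √D`; this is `O(D * √D / s)` if
`q` is the integer part of `s`, and `O(D)` if `q = b`. -/
theorem level_colors_le {D q : ℕ} {s : ℝ} (hs : 1 ≤ s) (hD : 1 ≤ D)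
    (hq : q = min ⌊s⌋₊ (Nat.sqrt D + 1)) :
    (((Nat.sqrt D + 1) * (35 * (D / q) + 35 + 64 * (Nat.sqrt D + 1)) : ℕ) : ℝ) ≤
      1724 * (D * √D / s + D) := by
  have hS : 1 ≤ ⌊s⌋₊ := Nat.one_le_floor_iff s |>.2 hs
  have hq1 : 1 ≤ q := by rw [hq]; exact le_min hS (by omega)
  have hq0 : (0 : ℝ) < q := by exact_mod_cast hq1
  have hD' : (1 : ℝ) ≤ D := by exact_mod_cast hD
  have hs0 : (0 : ℝ) < s := by linarith
  set b : ℝ := ((Nat.sqrt D + 1 : ℕ) : ℝ) with hb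
  have hb1 : 1 ≤ b := by rw [hb]; exact_mod_cast Nat.succ_le_succ (Nat.zero_le _)
  have hbs : b ≤ 2 * √D := by
    have h1 : ((Nat.sqrt D : ℕ) : ℝ) ≤ √D := Real.nat_sqrt_le_real_sqrt
    have h2 : 1 ≤ √(D : ℝ) := Real.one_le_sqrt.2 hD'
    rw [hb]; push_cast; linarith
  have hbb : b * b ≤ 4 * D := by
    have := Real.mul_self_sqrt (show (0 : ℝ) ≤ D by linarith)
    nlinarith [Real.sqrt_nonneg (D : ℝ)]
  have hqb : (q : ℝ) ≤ b := by
    rw [hb]; exact_mod_cast (hq ▸ min_le_right _ _)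
  set x : ℝ := (D : ℝ) / q with hx
  have hxq : x * q = D := div_mul_cancel₀ _ hq0.ne'
  have hx0 : 0 ≤ x := by positivity
  have hbx : b ≤ 4 * x := by
    have h1 : b * q ≤ 4 * x * q := by nlinarith
    exact le_of_mul_le_mul_right h1 hq0
  have hdiv : ((D / q : ℕ) : ℝ) ≤ x := Nat.cast_div_le
  have hmain : b * x ≤ 4 * (D * √D / s + D) := by
    have hpos : 0 ≤ D * √D / s := by positivity
    rcases min_choice ⌊s⌋₊ (Nat.sqrt D + 1) with h | h
    · have h1 : s ≤ 2 * q := by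
        have h2 := Nat.lt_floor_add_one s
        rw [hq, h]
        have h3 : (1 : ℝ) ≤ ⌊s⌋₊ := by exact_mod_cast hS
        linarith
      have h2 : x ≤ 2 * D / s := by
        rw [hx, div_le_div_iff₀ hq0 hs0]
        nlinarith
      calc b * x ≤ (2 * √D) * (2 * D / s) := by gcongr
        _ = 4 * (D * √D / s) := by ring
        _ ≤ _ := by nlinarith
    · have h1 : (q : ℝ) = b := by rw [hq, h]
      rw [← h1, mul_comm, hxq]
      nlinarith
  have hle : (((Nat.sqrt D + 1) * (35 * (D / q) + 35 + 64 * (Nat.sqrt D + 1)) : ℕ) : ℝ) ≤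
      b * (431 * x) := by
    rw [Nat.cast_mul, ← hb]
    refine mul_le_mul_of_nonneg_left ?_ (by linarith)
    rw [Nat.cast_add, Nat.cast_add, Nat.cast_mul, Nat.cast_mul, ← hb]
    push_cast
    linarith
  nlinarith

/-- The recursion on the degree: if `(3 / 4) ^ h * D ≤ 8 * gam ^ 2`, then `h` random bipartitions
suffice before the remaining graph can be stored. -/
theorem hasColorer_of_degree_le [Nonempty V] {lam gam : ℕ} {s : ℝ} (hs : 1 ≤ s)
    (hlam : Fintype.card V < 2 ^ lam) (hgam : 1 ≤ gam) (h : ℕ) :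
    ∀ D, 1 ≤ D → D ≤ Fintype.card V → D * 3 ^ h ≤ 8 * gam ^ 2 * 4 ^ h →
      HasColorer V D
        ((h + 1) * (Fintype.card V * ⌊s⌋₊ * (15 * lam + 8 * gam + 16 * lam * gam ^ 2)))
        (6896 * (D * √D / s + D)) ((h + 1 : ℕ) * (2 ^ (10 * lam) / 2 ^ gam)) := by
  have hS : 1 ≤ ⌊s⌋₊ := Nat.one_le_floor_iff s |>.2 hs
  have hs0 : (0 : ℝ) < s := by linarith
  have hlam0 : 1 ≤ lam := by
    rcases Nat.eq_zero_or_pos lam with h | h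
    · have := Fintype.card_pos (α := V)
      rw [h] at hlam; omega
    · exact h
  set n := Fintype.card V with hn
  set β := n * ⌊s⌋₊ * (15 * lam + 8 * gam + 16 * lam * gam ^ 2) with hβ
  have hbase : ∀ h D, 1 ≤ D → D ≤ 8 * gam ^ 2 → HasColorer V D ((h + 1) * β)
      (6896 * (D * √D / s + D)) ((h + 1 : ℕ) * (2 ^ (10 * lam) / 2 ^ gam)) := by
    intro h D hD1 hD
    refine (hasColorer_store hlam D).mono ?_ ?_ (by positivity)
    · calc 2 * lam * (n * D) ≤ 2 * lam * (n * (8 * gam ^ 2)) := by gcongr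
        _ = 1 * (n * 1 * (16 * lam * gam ^ 2)) := by ring
        _ ≤ (h + 1) * (n * ⌊s⌋₊ * (15 * lam + 8 * gam + 16 * lam * gam ^ 2)) := by
          gcongr
          · omega
          · omega
    · have h1 : (1 : ℝ) ≤ D := by exact_mod_cast hD1
      have h2 : 0 ≤ D * √D / s := by positivity
      linarith
  induction h with
  | zero =>
    intro D hD1 _ hD
    exact hbase 0 D hD1 (by simpa using hD)
  | succ h ih =>
    intro D hD1 hDn hD
    by_cases hsmall : D ≤ 8 * gam ^ 2
    · exact hbase _ D hD1 hsmall
    · have hlarge : 8 * gam ^ 2 < D := not_le.1 hsmall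
      have hgg : gam ≤ gam ^ 2 := Nat.le_self_pow (by norm_num) gam
      have hgD : 8 * gam ≤ D := by omega
      have hgb : gam ≤ Nat.sqrt D + 1 := by
        have : gam ≤ Nat.sqrt D := by
          rw [Nat.le_sqrt, ← pow_two]
          omega
        omega
      have h34 : 4 * (3 * D / 4) ≤ 3 * D := Nat.mul_div_le _ _
      have hrec := ih (3 * D / 4) (by omega) (by omega) (by
        have h1 : 4 * (3 * D / 4) * 3 ^ h ≤ 3 * D * 3 ^ h := Nat.mul_le_mul_right _ h34
        have h2 : 3 * D * 3 ^ h = D * 3 ^ (h + 1) := by ring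
        have h3 : 8 * gam ^ 2 * 4 ^ (h + 1) = 4 * (8 * gam ^ 2 * 4 ^ h) := by ring
        rw [h3] at hD
        have h4 : 4 * (3 * D / 4 * 3 ^ h) ≤ 4 * (8 * gam ^ 2 * 4 ^ h) := by
          calc 4 * (3 * D / 4 * 3 ^ h) = 4 * (3 * D / 4) * 3 ^ h := by ring
            _ ≤ _ := h1.trans (h2.trans_le hD)
        omega)
      set q := min ⌊s⌋₊ (Nat.sqrt D + 1) with hq
      have hstep := HasColorer.step hlam hgam hDn (q := q) (le_min hS (by omega)) (min_le_right _ _)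
        hgb hgD hrec
      refine hstep.mono ?_ ?_ ?_
      · have h1 : n + n * q * (14 * lam + 8 * gam) ≤ β := by
          calc n + n * q * (14 * lam + 8 * gam)
              ≤ n * ⌊s⌋₊ * lam + n * ⌊s⌋₊ * (14 * lam + 8 * gam) := by
                gcongr
                · rw [mul_assoc]
                  exact Nat.le_mul_of_pos_right _ (Nat.mul_pos hS hlam0)
                · exact min_le_left _ _
            _ = n * ⌊s⌋₊ * (15 * lam + 8 * gam) := by ring
            _ ≤ β := Nat.mul_le_mul_left _ (Nat.le_add_right _ _)
        calc _ ≤ β + (h + 1) * β := Nat.add_le_add_right h1 _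
          _ = (h + 1 + 1) * β := by ring
      · have h1 := level_colors_le hs hD1 hq
        have h2 : ((3 * D / 4 : ℕ) : ℝ) ≤ 3 / 4 * D := by
          have : ((4 * (3 * D / 4) : ℕ) : ℝ) ≤ ((3 * D : ℕ) : ℝ) := Nat.cast_le.2 h34
          push_cast at this
          linarith
        have h3 : √((3 * D / 4 : ℕ) : ℝ) ≤ √D := by
          apply Real.sqrt_le_sqrt
          have : (0 : ℝ) ≤ D := Nat.cast_nonneg D
          linarith
        have h4 : ((3 * D / 4 : ℕ) : ℝ) * √((3 * D / 4 : ℕ) : ℝ) / s ≤ 3 / 4 * (D * √D / s) := by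
          calc ((3 * D / 4 : ℕ) : ℝ) * √((3 * D / 4 : ℕ) : ℝ) / s ≤ (3 / 4 * D) * √D / s := by gcongr
            _ = _ := by ring
        linarith
      · rw [Nat.cast_add (h + 1) 1]
        linarith

end Recursion

/-! ### Streaming edge coloring of general graphs -/

theorem IsArrivalOrder.isStream {V : Type} [Fintype V] [DecidableEq V] {G : SimpleGraph V}
    [DecidableRel G.Adj] {σ : List (Sym2 V)} (hσ : IsArrivalOrder G σ) {D : ℕ}
    (hD : ∀ v, G.degree v ≤ D) : IsStream D σ where
  nodup := hσ.1
  not_isDiag e he := G.not_isDiag_of_mem_edgeSet ((hσ.2 e).1 he)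
  degree_le v := by
    refine le_trans ?_ (hD v)
    rw [← List.toFinset_card_of_nodup (hσ.1.filter _), ← G.card_neighborFinset_eq_degree]
    refine le_trans (Finset.card_le_card ?_) (Finset.card_image_le (f := fun y => s(v, y)))
    intro e he
    rw [List.mem_toFinset, List.mem_filter, decide_eq_true_eq] at he
    obtain ⟨h1, y, rfl⟩ := he
    refine Finset.mem_image.2 ⟨y, ?_, rfl⟩
    rw [SimpleGraph.mem_neighborFinset]
    exact (hσ.2 _).1 h1

/-- An algorithm for graphs without edges needs neither memory nor colors. -/
theorem exists_streamingColoringAlgorithm_of_no_edges (V : Type) :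
    ∃ A : StreamingColoringAlgorithm V 0 0, ∀ G : SimpleGraph V, G = ⊥ → ∀ σ : List (Sym2 V),
      IsArrivalOrder G σ → 1 ≤ A.successProb G σ := by
  obtain ⟨A, hA⟩ := exists_streamingColoringAlgorithm (V := V) (Ω := Unit) (S := Unit) (κ := Empty)
    (fun _ => ⟨(), fun _ _ => ((), []), fun _ => []⟩) (b := 0) (K := 0) (by simp) (by simp)
  refine ⟨A, fun G hG σ hσ => ?_⟩
  have hnil : σ = [] := by
    rw [List.eq_nil_iff_forall_not_mem]
    intro e he
    have := (hσ.2 e).1 he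
    rw [hG, SimpleGraph.edgeSet_bot] at this
    exact this
  subst hnil
  have h := hA G [] hσ
  rw [unifProb_of_forall_not, sub_zero] at h
  · exact h
  · intro _ hcon
    exact hcon ⟨List.Perm.refl _, by simp [OnlineColorer.output, OnlineColorer.outputFrom]⟩

theorem rpow_three_halves (x : ℝ) (hx : 0 < x) : x ^ (3 / 2 : ℝ) = x * √x := by
  rw [show (3 / 2 : ℝ) = 1 + 1 / 2 by norm_num, Real.rpow_add hx, Real.rpow_one, Real.sqrt_eq_rpow]

theorem three_mul_add_one_le (m : ℕ) : 3 * m + 1 ≤ (2 ^ 2) ^ m := by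
  induction m with
  | zero => simp
  | succ m ih => rw [pow_succ]; omega

theorem natLog_two_add_one_le {n : ℕ} (hn : 2 ≤ n) : ((Nat.log 2 n + 1 : ℕ) : ℝ) ≤ 3 * Real.log n := by
  have h1 : (Nat.log 2 n : ℝ) * Real.log 2 ≤ Real.log n := by
    rw [← Real.log_pow]
    refine Real.log_le_log (by positivity) ?_
    exact_mod_cast Nat.pow_log_le_self 2 (by omega)
  have h2 : Real.log 2 ≤ Real.log n :=
    Real.log_le_log (by norm_num) (by exact_mod_cast hn)
  have h3 := Real.log_two_gt_d9
  push_cast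
  nlinarith [Nat.cast_nonneg (α := ℝ) (Nat.log 2 n)]

theorem theorem1 :
    ∀ c : ℕ, ∃ (C : ℝ) (k : ℕ), ∀ (n Δ : ℕ) (s : ℝ), 1 ≤ s →
      ∃ b K : ℕ,
        (b : ℝ) ≤ C * (n * s) * Real.log n ^ k ∧
        (K : ℝ) ≤ C * ((Δ : ℝ) ^ (3 / 2 : ℝ) / s + Δ) ∧
        ∃ A : StreamingColoringAlgorithm (Fin n) b K,
          ∀ (G : SimpleGraph (Fin n)) [DecidableRel G.Adj], G.maxDegree ≤ Δ →
            ∀ σ : List (Sym2 (Fin n)), IsArrivalOrder G σ →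
              1 - 1 / (n : ℝ) ^ c ≤ A.successProb G σ := by
  intro c
  set κ := c + 12 with hκ
  set C₀ : ℕ := 4 * (15 + 8 * κ + 16 * κ ^ 2) * 81 with hC₀
  refine ⟨C₀ + 6896, 4, fun n Δ s hs => ?_⟩
  have hs0 : (0 : ℝ) < s := by linarith
  have hlog : 0 ≤ Real.log n := Real.log_natCast_nonneg n
  by_cases htriv : n ≤ 1 ∨ Δ = 0
  · obtain ⟨A, hA⟩ := exists_streamingColoringAlgorithm_of_no_edges (Fin n)
    refine ⟨0, 0, by rw [Nat.cast_zero]; positivity, by rw [Nat.cast_zero]; positivity, A, ?_⟩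
    intro G _ hG σ hσ
    refine le_trans ?_ (hA G ?_ σ hσ)
    · have : (0 : ℝ) ≤ 1 / (n : ℝ) ^ c := by positivity
      linarith
    · rcases htriv with h | h
      · have : Subsingleton (Fin n) := Fin.subsingleton_iff_le_one.2 h
        exact Subsingleton.elim _ _
      · rw [eq_bot_iff]
        intro u v huv
        have h1 := (G.degree_le_maxDegree u).trans hG
        rw [h, Nat.le_zero, ← G.card_neighborFinset_eq_degree, Finset.card_eq_zero] at h1
        have h2 : v ∈ G.neighborFinset u := by simpa using huv
        rw [h1] at h2
        simp at h2
  · obtain ⟨hn, hΔ⟩ : 2 ≤ n ∧ 1 ≤ Δ := by omega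
    have : Nonempty (Fin n) := ⟨⟨0, by omega⟩⟩
    set lam := Nat.log 2 n + 1 with hlam
    have hnlam : n < 2 ^ lam := Nat.lt_pow_succ_log_self (by norm_num) n
    set gam := κ * lam with hgam
    have hgam1 : 1 ≤ gam := Nat.mul_pos (by omega) (by omega)
    set D := min Δ n with hD
    have hD1 : 1 ≤ D := le_min hΔ (by omega)
    have hDn : D ≤ n := min_le_right _ _
    -- after `3 * lam` levels, the degree bound `(3 / 4) ^ (3 * lam) * n` is less than `1`
    have hdepth : D * 3 ^ (3 * lam) ≤ 8 * gam ^ 2 * 4 ^ (3 * lam) := by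
      calc D * 3 ^ (3 * lam) ≤ 2 ^ lam * 3 ^ (3 * lam) := by gcongr; omega
        _ = 54 ^ lam := by rw [pow_mul, ← mul_pow]; norm_num
        _ ≤ 64 ^ lam := Nat.pow_le_pow_left (by norm_num) _
        _ = 1 * 4 ^ (3 * lam) := by rw [pow_mul]; norm_num
        _ ≤ 8 * gam ^ 2 * 4 ^ (3 * lam) := by
          gcongr
          have := Nat.one_le_pow 2 gam hgam1
          omega
    obtain ⟨Ω, S, κc, i1, i2, i3, i4, A, hA, hK, hp⟩ := hasColorer_of_degree_le (V := Fin n) hs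
      (by simpa using hnlam) hgam1 (3 * lam) D hD1 (by simpa using hDn) hdepth
    obtain ⟨B, hB⟩ := exists_streamingColoringAlgorithm A hA le_rfl
    refine ⟨_, _, ?_, ?_, B, ?_⟩
    · rw [Fintype.card_fin]
      have h1 : (3 * lam + 1) * (n * ⌊s⌋₊ * (15 * lam + 8 * gam + 16 * lam * gam ^ 2)) ≤
          (4 * (15 + 8 * κ + 16 * κ ^ 2)) * (n * ⌊s⌋₊) * lam ^ 4 := by
        have hl : 1 ≤ lam := by omega
        have h2 : lam ≤ lam ^ 3 := Nat.le_self_pow (by norm_num) lam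
        calc (3 * lam + 1) * (n * ⌊s⌋₊ * (15 * lam + 8 * gam + 16 * lam * gam ^ 2))
            ≤ (4 * lam) * (n * ⌊s⌋₊ * (15 * lam ^ 3 + 8 * (κ * lam ^ 3) +
                16 * lam * (κ * lam) ^ 2)) := by
              rw [hgam]
              gcongr
              omega
          _ = _ := by ring
      have h3 : ((⌊s⌋₊ : ℕ) : ℝ) ≤ s := Nat.floor_le hs0.le
      have h4 : (lam : ℝ) ^ 4 ≤ 81 * Real.log n ^ 4 := by
        calc (lam : ℝ) ^ 4 ≤ (3 * Real.log n) ^ 4 :=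
              pow_le_pow_left₀ (Nat.cast_nonneg _) (natLog_two_add_one_le hn) 4
          _ = _ := by ring
      calc _ ≤ (((4 * (15 + 8 * κ + 16 * κ ^ 2)) * (n * ⌊s⌋₊) * lam ^ 4 : ℕ) : ℝ) :=
            Nat.cast_le.2 h1
        _ = ((4 * (15 + 8 * κ + 16 * κ ^ 2) : ℕ) : ℝ) * (n * (⌊s⌋₊ : ℕ)) * (lam : ℝ) ^ 4 := by
            push_cast; ring
        _ ≤ ((4 * (15 + 8 * κ + 16 * κ ^ 2) : ℕ) : ℝ) * (n * s) * (81 * Real.log n ^ 4) := by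
            gcongr
        _ = (C₀ : ℝ) * (n * s) * Real.log n ^ 4 := by
            rw [hC₀, Nat.cast_mul _ 81]; push_cast; ring
        _ ≤ (C₀ + 6896) * (n * s) * Real.log n ^ 4 := by
            gcongr
            linarith
    · have hD0 : (0 : ℝ) < D := by exact_mod_cast hD1
      have hΔ0 : (0 : ℝ) < Δ := by exact_mod_cast hΔ
      have hDΔ : (D : ℝ) ≤ Δ := by exact_mod_cast min_le_left Δ n
      rw [rpow_three_halves _ hΔ0]
      calc _ ≤ 6896 * (D * √D / s + D) := hK
        _ ≤ 6896 * (Δ * √Δ / s + Δ) := by gcongr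
        _ ≤ (C₀ + 6896) * (Δ * √Δ / s + Δ) := by
          gcongr
          have : (0 : ℝ) ≤ C₀ := Nat.cast_nonneg _
          linarith
    · intro G _ hG σ hσ
      refine le_trans ?_ (hB G σ hσ)
      have hstream : IsStream D σ := hσ.isStream fun v => le_min
        ((G.degree_le_maxDegree v).trans hG)
        ((G.degree_lt_card_verts v).le.trans (by simp))
      have h1 := hp σ hstream
      have h2 : ((3 * lam + 1 : ℕ) : ℝ) * (2 ^ (10 * lam) / 2 ^ gam) ≤ 1 / (n : ℝ) ^ c := by
        have h3 : 3 * lam + 1 ≤ 2 ^ (2 * lam) := by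
          rw [pow_mul]
          exact three_mul_add_one_le lam
        have h4 : n ^ c ≤ 2 ^ (lam * c) := by
          rw [pow_mul]
          exact Nat.pow_le_pow_left hnlam.le c
        rw [← mul_div_assoc, div_le_div_iff₀ (by positivity) (by positivity), one_mul]
        have h6 : (3 * lam + 1) * 2 ^ (10 * lam) * n ^ c ≤ 2 ^ gam := by
          calc (3 * lam + 1) * 2 ^ (10 * lam) * n ^ c
              ≤ 2 ^ (2 * lam) * 2 ^ (10 * lam) * 2 ^ (lam * c) := by gcongr
            _ = 2 ^ gam := by
              rw [← pow_add, ← pow_add, hgam, hκ]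
              congr 1; ring
        exact_mod_cast h6
      linarith
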